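/- Let $m\ge 1$ and let $M$ be a smooth manifold of dimension $n=2m+1$ with a K-contact structure $(\varphi,\xi,\eta,g)$: $g$ is a smooth Riemannian metric, $\eta$ a smooth 1-form with $\eta\wedge(d\eta)^m\neq 0$ everywhere, $\xi$ a smooth vector field and $\varphi$ a smooth $(1,1)$-tensor field such that, for all vector fields $X,Y$, $$\eta(\xi)=1,\quad d\eta(\xi,\cdot)=0,\quad \eta(X)=g(\xi,X),\quad d\eta(X,Y)=g(X,\varphi Y),\quad \varphi^2=-I+\eta\otimes\xi ,$$ where $2\,d\eta(X,Y)=X\eta(Y)-Y\eta(X)-\eta([X,Y])$, and $\xi$ is a Killing field for $g$. Let $R(X,Y)Z=\nabla_X\nabla_YZ-\nabla_Y\nabla_XZ-\nabla_{[X,Y]}Z$ be the curvature tensor of the Levi-Civita connection, $\mathrm{Ric}(Y,Z)=\operatorname{tr}(X\mapsto R(X,Y)Z)$ the Ricci tensor, $Q$ the Ricci operator, $g(QX,Y)=\mathrm{Ric}(X,Y)$, $r=\operatorname{tr}Q$ the scalar curvature, and $$W(X,Y)Z=R(X,Y)Z+\tfrac1{n-2}\big[\mathrm{Ric}(X,Z)Y-\mathrm{Ric}(Y,Z)X+g(X,Z)QY-g(Y,Z)QX\big]-\tfrac{r}{(n-1)(n-2)}\big[g(X,Z)Y-g(Y,Z)X\big]$$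 the Weyl tensor. (i) $W(X,\xi)\xi=0$ for all $X$ if and only if $M$ is $\eta$-Einstein, i.e. $\mathrm{Ric}=a\,g+b\,\eta\otimes\eta$ for some smooth functions $a,b$ on $M$. (ii) If $W(X,Y)\xi=0$ for all $X,Y$, then $M$ is Sasakian, i.e. the contact metric structure is normal, $[\varphi,\varphi]+2\,d\eta\otimes\xi=0$, where $[\varphi,\varphi](X,Y)=\varphi^2[X,Y]+[\varphi X,\varphi Y]-\varphi[\varphi X,Y]-\varphi[X,\varphi Y]$ (equivalently, the almost Kähler structure induced on the cone $M\times(0,\infty)$ with metric $dr^2+r^2g$ is integrable); and $M$ is $\eta$-Einstein, i.e. quasi-Einstein with respect to the unit vector field $\xi$: $\mathrm{Ric}=a\,g+b\,u\otimes u$ for some smooth functions $a,b$, with $u=g(\xi,\cdot)$. -/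

import Mathlib

open Bundle Manifold FiberBundle VectorField Module
open scoped ContDiff Topology

/-! Riemannian manifolds `M` are modelled on a finite-dimensional real vector space `E`
(no boundary); the metric `g` is the smooth Riemannian metric `inner ℝ` on the tangent bundle.
For `f : M → ℝ`, `mvfderiv 𝓘(ℝ, E) f x v` is the derivative of `f` in the direction `v ∈ T_x M`;
`mlieBracket 𝓘(ℝ, E) X Y` is the Lie bracket `[X, Y]`; for `v ∈ T_x M`, `extend E v` is a vector
field that is smooth near `x` and takes the value `v` at `x`. Tensors are evaluated on tangent
vectors at `x` through such extensions. -/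

noncomputable section RiemannianGeometry

namespace ContactGeometry

variable {E : Type*} [NormedAddCommGroup E] [NormedSpace ℝ E]
  {M : Type*} [TopologicalSpace M] [ChartedSpace E M]

/-- Vector fields on `M` (no regularity required). -/
abbrev VField (E : Type*) [NormedAddCommGroup E] [NormedSpace ℝ E]
    (M : Type*) [TopologicalSpace M] [ChartedSpace E M] : Type _ :=
  Π x : M, TangentSpace 𝓘(ℝ, E) x

instance finiteDimensional_tangentSpace [FiniteDimensional ℝ E] (x : M) :
    FiniteDimensional ℝ (TangentSpace 𝓘(ℝ, E) x) :=
  inferInstanceAs (FiniteDimensional ℝ E)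

variable [IsManifold 𝓘(ℝ, E) ∞ M]

/-! ### The Levi-Civita connection -/

variable [RiemannianBundle (fun x : M ↦ TangentSpace 𝓘(ℝ, E) x)]

/-- The Koszul expression, which is `g(∇_X Y, Z)` for the Levi-Civita connection `∇`. -/
def koszul (X Y Z : VField E M) (x : M) : ℝ :=
  (1 / 2 : ℝ) *
    (mvfderiv 𝓘(ℝ, E) (fun y ↦ inner ℝ (Y y) (Z y)) x (X x)
      + mvfderiv 𝓘(ℝ, E) (fun y ↦ inner ℝ (Z y) (X y)) x (Y x)
      - mvfderiv 𝓘(ℝ, E) (fun y ↦ inner ℝ (X y) (Y y)) x (Z x)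
      + inner ℝ (mlieBracket 𝓘(ℝ, E) X Y x) (Z x)
      - inner ℝ (mlieBracket 𝓘(ℝ, E) Y Z x) (X x)
      + inner ℝ (mlieBracket 𝓘(ℝ, E) Z X x) (Y x))

variable [FiniteDimensional ℝ E]

/-- A `g`-orthonormal basis of `T_x M`. -/
abbrev onb (x : M) :
    OrthonormalBasis (Fin (finrank ℝ (TangentSpace 𝓘(ℝ, E) x))) ℝ (TangentSpace 𝓘(ℝ, E) x) :=
  stdOrthonormalBasis ℝ (TangentSpace 𝓘(ℝ, E) x)

/-- `∇_X Y`, from the Koszul formula. -/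
def nabla (X Y : VField E M) (x : M) : TangentSpace 𝓘(ℝ, E) x :=
  ∑ i, koszul X Y (extend E (onb x i)) x • onb x i

variable [IsContMDiffRiemannianBundle 𝓘(ℝ, E) ∞ E (fun x : M ↦ TangentSpace 𝓘(ℝ, E) x)]

instance contMDiffRiemannian_one :
    IsContMDiffRiemannianBundle 𝓘(ℝ, E) 1 E (fun x : M ↦ TangentSpace 𝓘(ℝ, E) x) :=
  inferInstance

section LeviCivita

set_option linter.unusedSectionVars false

variable {X X' Y Y' Z Z' : VField E M} {f : M → ℝ} {x : M}

lemma mdifferentiableAt_inner (hX : MDiffAt (T% X) x) (hY : MDiffAt (T% Y) x) :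
    MDiffAt (fun y ↦ (inner ℝ (X y) (Y y) : ℝ)) x :=
  MDifferentiableAt.inner_bundle (IB := 𝓘(ℝ, E)) (F := E)
    (E := fun x : M ↦ TangentSpace 𝓘(ℝ, E) x) (b := fun y ↦ y) hX hY

lemma mdiffAt_ext (v : TangentSpace 𝓘(ℝ, E) x) :
    MDiffAt (T% (extend E v : VField E M)) x :=
  FiberBundle.mdifferentiableAt_extend ..

lemma koszul_smul_left (hX : MDiffAt (T% X) x) (hY : MDiffAt (T% Y) x) (hZ : MDiffAt (T% Z) x)
    (hf : MDiffAt f x) : koszul (f • X) Y Z x = f x * koszul X Y Z x := by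
  have e1 : (fun y ↦ inner ℝ (Z y) ((f • X) y)) = fun y ↦ f y * inner ℝ (Z y) (X y) := by
    ext y; simp [inner_smul_right]
  have e2 : (fun y ↦ inner ℝ ((f • X) y) (Y y)) = fun y ↦ f y * inner ℝ (X y) (Y y) := by
    ext y; simp [inner_smul_left]
  simp only [koszul, e1, e2, mvfderiv_fun_mul hf (mdifferentiableAt_inner hZ hX),
    mvfderiv_fun_mul hf (mdifferentiableAt_inner hX hY),
    mlieBracket_smul_left hf hX, mlieBracket_smul_right hf hX]
  simp [inner_add_left, inner_smul_left, inner_smul_right, inner_neg_left, real_inner_comm]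
  ring

lemma koszul_add_left (hX : MDiffAt (T% X) x) (hX' : MDiffAt (T% X') x) (hY : MDiffAt (T% Y) x)
    (hZ : MDiffAt (T% Z) x) : koszul (X + X') Y Z x = koszul X Y Z x + koszul X' Y Z x := by
  have e1 : (fun y ↦ inner ℝ (Z y) ((X + X') y)) =
      fun y ↦ inner ℝ (Z y) (X y) + inner ℝ (Z y) (X' y) := by
    ext y; simp [inner_add_right]
  have e2 : (fun y ↦ inner ℝ ((X + X') y) (Y y)) =
      fun y ↦ inner ℝ (X y) (Y y) + inner ℝ (X' y) (Y y) := by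
    ext y; simp [inner_add_left]
  simp only [koszul, e1, e2,
    mvfderiv_fun_add (mdifferentiableAt_inner hZ hX) (mdifferentiableAt_inner hZ hX'),
    mvfderiv_fun_add (mdifferentiableAt_inner hX hY) (mdifferentiableAt_inner hX' hY),
    mlieBracket_add_left hX hX', mlieBracket_add_right hX hX']
  simp [inner_add_left, inner_add_right]
  ring

lemma koszul_smul_mid (hX : MDiffAt (T% X) x) (hY : MDiffAt (T% Y) x) (hZ : MDiffAt (T% Z) x)
    (hf : MDiffAt f x) : koszul X (f • Y) Z x =
      f x * koszul X Y Z x + mvfderiv 𝓘(ℝ, E) f x (X x) * inner ℝ (Y x) (Z x) := by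
  have e1 : (fun y ↦ inner ℝ ((f • Y) y) (Z y)) = fun y ↦ f y * inner ℝ (Y y) (Z y) := by
    ext y; simp [inner_smul_left]
  have e2 : (fun y ↦ inner ℝ (X y) ((f • Y) y)) = fun y ↦ f y * inner ℝ (X y) (Y y) := by
    ext y; simp [inner_smul_right]
  simp only [koszul, e1, e2, mvfderiv_fun_mul hf (mdifferentiableAt_inner hY hZ),
    mvfderiv_fun_mul hf (mdifferentiableAt_inner hX hY),
    mlieBracket_smul_left hf hY, mlieBracket_smul_right hf hY]
  simp [inner_add_left, inner_smul_left, inner_smul_right, inner_neg_left, real_inner_comm]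
  ring

lemma koszul_add_mid (hX : MDiffAt (T% X) x) (hY : MDiffAt (T% Y) x) (hY' : MDiffAt (T% Y') x)
    (hZ : MDiffAt (T% Z) x) : koszul X (Y + Y') Z x = koszul X Y Z x + koszul X Y' Z x := by
  have e1 : (fun y ↦ inner ℝ ((Y + Y') y) (Z y)) =
      fun y ↦ inner ℝ (Y y) (Z y) + inner ℝ (Y' y) (Z y) := by
    ext y; simp [inner_add_left]
  have e2 : (fun y ↦ inner ℝ (X y) ((Y + Y') y)) =
      fun y ↦ inner ℝ (X y) (Y y) + inner ℝ (X y) (Y' y) := by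
    ext y; simp [inner_add_right]
  simp only [koszul, e1, e2,
    mvfderiv_fun_add (mdifferentiableAt_inner hY hZ) (mdifferentiableAt_inner hY' hZ),
    mvfderiv_fun_add (mdifferentiableAt_inner hX hY) (mdifferentiableAt_inner hX hY'),
    mlieBracket_add_left hY hY', mlieBracket_add_right hY hY']
  simp [inner_add_left, inner_add_right]
  ring

lemma koszul_smul_right (hX : MDiffAt (T% X) x) (hY : MDiffAt (T% Y) x)
    (hZ : MDiffAt (T% Z) x) (hf : MDiffAt f x) :
    koszul X Y (f • Z) x = f x * koszul X Y Z x := by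
  have e1 : (fun y ↦ inner ℝ ((f • Z) y) (X y)) = fun y ↦ f y * inner ℝ (Z y) (X y) := by
    ext y; simp [inner_smul_left]
  have e2 : (fun y ↦ inner ℝ (Y y) ((f • Z) y)) = fun y ↦ f y * inner ℝ (Y y) (Z y) := by
    ext y; simp [inner_smul_right]
  simp only [koszul, e1, e2, mvfderiv_fun_mul hf (mdifferentiableAt_inner hZ hX),
    mvfderiv_fun_mul hf (mdifferentiableAt_inner hY hZ),
    mlieBracket_smul_left hf hZ, mlieBracket_smul_right hf hZ]
  simp [inner_add_left, inner_smul_left, inner_smul_right, inner_neg_left, real_inner_comm]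
  ring

lemma koszul_add_right (hX : MDiffAt (T% X) x) (hY : MDiffAt (T% Y) x) (hZ : MDiffAt (T% Z) x)
    (hZ' : MDiffAt (T% Z') x) : koszul X Y (Z + Z') x = koszul X Y Z x + koszul X Y Z' x := by
  have e1 : (fun y ↦ inner ℝ ((Z + Z') y) (X y)) =
      fun y ↦ inner ℝ (Z y) (X y) + inner ℝ (Z' y) (X y) := by
    ext y; simp [inner_add_left]
  have e2 : (fun y ↦ inner ℝ (Y y) ((Z + Z') y)) =
      fun y ↦ inner ℝ (Y y) (Z y) + inner ℝ (Y y) (Z' y) := by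
    ext y; simp [inner_add_right]
  simp only [koszul, e1, e2,
    mvfderiv_fun_add (mdifferentiableAt_inner hZ hX) (mdifferentiableAt_inner hZ' hX),
    mvfderiv_fun_add (mdifferentiableAt_inner hY hZ) (mdifferentiableAt_inner hY hZ'),
    mlieBracket_add_left hZ hZ', mlieBracket_add_right hZ hZ']
  simp [inner_add_left, inner_add_right]
  ring

lemma nabla_tensorial (hY : MDiffAt (T% Y) x) :
    TensorialAt 𝓘(ℝ, E) E (fun X : VField E M ↦ nabla X Y x) x where
  smul hf hX := by
    simp [nabla, koszul_smul_left hX hY (mdiffAt_ext _) hf, Finset.smul_sum, mul_smul]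
  add hX hX' := by
    simp [nabla, koszul_add_left hX hX' hY (mdiffAt_ext _), Finset.sum_add_distrib,
      add_smul]

lemma inner_nabla (hX : MDiffAt (T% X) x) (hY : MDiffAt (T% Y) x) (hZ : MDiffAt (T% Z) x) :
    inner ℝ (nabla X Y x) (Z x) = koszul X Y Z x := by
  have hT : TensorialAt 𝓘(ℝ, E) E (fun Z : VField E M ↦ koszul X Y Z x) x :=
    ⟨fun hf hZ ↦ koszul_smul_right hX hY hZ hf, fun hZ hZ' ↦ koszul_add_right hX hY hZ hZ'⟩
  have h1 (v : TangentSpace 𝓘(ℝ, E) x) :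
      koszul X Y (extend E v) x = TensorialAt.mkHom _ x hT v := rfl
  rw [← TensorialAt.mkHom_apply hT hZ]
  conv_rhs => rw [← (onb x).sum_repr' (Z x)]
  simp only [nabla, h1, sum_inner, inner_smul_left, map_sum, map_smul, smul_eq_mul]
  exact Finset.sum_congr rfl fun i _ ↦ by simp [mul_comm]

open Classical in
/-- The linear map `v ↦ ∇_v Y` on `T_x M` (zero where `Y` is not differentiable). -/
def nablaHom (Y : VField E M) (x : M) :
    TangentSpace 𝓘(ℝ, E) x →L[ℝ] TangentSpace 𝓘(ℝ, E) x :=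
  if hY : MDiffAt (T% Y) x then TensorialAt.mkHom _ x (nabla_tensorial hY) else 0

lemma nablaHom_apply (hY : MDiffAt (T% Y) x) (v : TangentSpace 𝓘(ℝ, E) x) :
    nablaHom Y x v = nabla (extend E v) Y x := by
  simp only [nablaHom, hY, dif_pos]; rfl

variable (E M) in
/-- The Levi-Civita connection of `M`; `leviCivita E M Y x v` is `∇_v Y` for `v ∈ T_x M`. -/
def leviCivita : CovariantDerivative 𝓘(ℝ, E) E (fun x : M ↦ TangentSpace 𝓘(ℝ, E) x) where
  toFun := nablaHom
  isCovariantDerivativeOnUniv :=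
  { add := by
      intro Y Y' x hY hY' _
      ext v
      rw [nablaHom_apply (mdifferentiableAt_add_section hY hY')]
      simp [nablaHom_apply hY, nablaHom_apply hY', nabla,
        koszul_add_mid (mdiffAt_ext v) hY hY' (mdiffAt_ext _),
        Finset.sum_add_distrib, add_smul]
    leibniz := by
      intro Y g x hY hg _
      ext v
      rw [nablaHom_apply (hg.smul_section hY)]
      simp only [add_apply, smul_apply, nablaHom_apply hY,
        nabla, koszul_smul_mid (mdiffAt_ext v) hY (mdiffAt_ext _) hg,
        Finset.smul_sum, mul_smul, extend_apply_self,
        Finset.sum_add_distrib, add_smul, ContinuousLinearMap.smulRight_apply]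
      rw [← Finset.smul_sum, ← Finset.smul_sum]
      congr 2
      conv_rhs => rw [← (onb x).sum_repr' (Y x)]
      simp [real_inner_comm] }

lemma inner_leviCivita (hX : MDiffAt (T% X) x) (hY : MDiffAt (T% Y) x)
    (hZ : MDiffAt (T% Z) x) :
    inner ℝ (leviCivita E M Y x (X x)) (Z x) = koszul X Y Z x := by
  rw [← inner_nabla hX hY hZ]
  congr 1
  show nablaHom Y x (X x) = _
  simp only [nablaHom, hY, dif_pos]
  exact TensorialAt.mkHom_apply _ hX

/-- The connection is torsion-free. -/
theorem leviCivita_torsion : (leviCivita E M).torsion = 0 := by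
  rw [CovariantDerivative.torsion_eq_zero_iff]
  intro X Y x hX hY
  refine ext_inner_right ℝ fun v ↦ ?_
  have h1 := inner_leviCivita hX hY (mdiffAt_ext v)
  have h2 := inner_leviCivita hY hX (mdiffAt_ext v)
  rw [extend_apply_self] at h1 h2
  rw [inner_sub_left, h1, h2]
  have e (A B : VField E M) :
    (fun y ↦ (inner ℝ (A y) (B y) : ℝ)) = fun y ↦ inner ℝ (B y) (A y) := by
    ext y; exact real_inner_comm _ _
  unfold koszul
  rw [e (extend E v) X, e (extend E v) Y, e Y X,
    mlieBracket_swap_apply (V := Y) (W := X), mlieBracket_swap_apply (V := extend E v) (W := X),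
    mlieBracket_swap_apply (V := extend E v) (W := Y)]
  simp only [extend_apply_self, inner_neg_left]
  ring

/-- The connection is compatible with the metric. -/
theorem leviCivita_metric (hX : MDiffAt (T% X) x) (hY : MDiffAt (T% Y) x)
    (hZ : MDiffAt (T% Z) x) :
    mvfderiv 𝓘(ℝ, E) (fun y ↦ inner ℝ (Y y) (Z y)) x (X x) =
      inner ℝ (leviCivita E M Y x (X x)) (Z x) + inner ℝ (Y x) (leviCivita E M Z x (X x)) := by
  rw [inner_leviCivita hX hY hZ, real_inner_comm, inner_leviCivita hX hZ hY]
  have e (A B : VField E M) :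
    (fun y ↦ (inner ℝ (A y) (B y) : ℝ)) = fun y ↦ inner ℝ (B y) (A y) := by
    ext y; exact real_inner_comm _ _
  unfold koszul
  rw [e Y X, e X Z, e Z Y,
    mlieBracket_swap_apply (V := Y) (W := X), mlieBracket_swap_apply (V := Z) (W := X),
    mlieBracket_swap_apply (V := Z) (W := Y)]
  simp only [inner_neg_left]
  ring

end LeviCivita

/-! ### Curvature -/

/-- `R(X,Y)Z = ∇_X ∇_Y Z - ∇_Y ∇_X Z - ∇_[X,Y] Z` for vector fields. -/
def curvatureField (X Y Z : VField E M) (x : M) : TangentSpace 𝓘(ℝ, E) x :=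
  leviCivita E M (fun y ↦ leviCivita E M Z y (Y y)) x (X x)
    - leviCivita E M (fun y ↦ leviCivita E M Z y (X y)) x (Y x)
    - leviCivita E M Z x (mlieBracket 𝓘(ℝ, E) X Y x)

/-- The curvature tensor `R(u,v)w` on tangent vectors. -/
def riemann (x : M) (u v w : TangentSpace 𝓘(ℝ, E) x) : TangentSpace 𝓘(ℝ, E) x :=
  curvatureField (extend E u) (extend E v) (extend E w) x

/-- The Ricci tensor `Ric(v,w)`, the trace of `u ↦ R(u,v)w`. -/
def ricci (x : M) (v w : TangentSpace 𝓘(ℝ, E) x) : ℝ :=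
  ∑ i, inner ℝ (riemann x (onb x i) v w) (onb x i)

/-- The Ricci operator `Q`, with `g(Qv,w) = Ric(v,w)`. -/
def ricciOp (x : M) (v : TangentSpace 𝓘(ℝ, E) x) : TangentSpace 𝓘(ℝ, E) x :=
  ∑ i, ricci x v (onb x i) • onb x i

/-- The scalar curvature. -/
def scalarCurv (x : M) : ℝ := ∑ i, ricci x (onb (E := E) x i) (onb (E := E) x i)

/-- The Weyl tensor `W(u,v)w` of type (1,3) (meaningful if the dimension `n` is at least 3). -/
def weyl (x : M) (u v w : TangentSpace 𝓘(ℝ, E) x) : TangentSpace 𝓘(ℝ, E) x :=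
  let n : ℝ := finrank ℝ E
  riemann x u v w
    + (1 / (n - 2)) • (ricci x u w • v - ricci x v w • u
        + (inner ℝ u w : ℝ) • ricciOp x v - (inner ℝ v w : ℝ) • ricciOp x u)
    - (scalarCurv (E := E) x / ((n - 1) * (n - 2))) •
        ((inner ℝ u w : ℝ) • v - (inner ℝ v w : ℝ) • u)

end ContactGeometry

end RiemannianGeometry

/-! ### Contact metric geometry -/

noncomputable section ContactMetricGeometry

namespace ContactGeometry

variable {E : Type*} [NormedAddCommGroup E] [NormedSpace ℝ E] [FiniteDimensional ℝ E]
  {M : Type*} [TopologicalSpace M] [ChartedSpace E M] [IsManifold 𝓘(ℝ, E) ∞ M]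

/-- Exterior derivative of a 1-form, with the normalization
`2 dη(X,Y) = X(η(Y)) - Y(η(X)) - η([X,Y])` that is usual in contact metric geometry (and for
which the unit spheres are K-contact). -/
def extDeriv1 (η : Π x : M, TangentSpace 𝓘(ℝ, E) x →L[ℝ] ℝ) (x : M)
    (u v : TangentSpace 𝓘(ℝ, E) x) : ℝ :=
  (1 / 2 : ℝ) *
    (mvfderiv 𝓘(ℝ, E) (fun y ↦ η y (extend E v y)) x u
      - mvfderiv 𝓘(ℝ, E) (fun y ↦ η y (extend E u y)) x v
      - η x (mlieBracket 𝓘(ℝ, E) (extend E u) (extend E v) x))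

/-- `η ∧ (dη)^m` evaluated on `2m+1` tangent vectors (up to a positive constant factor
depending only on `m`). -/
def contactVolume (m : ℕ) (η : Π x : M, TangentSpace 𝓘(ℝ, E) x →L[ℝ] ℝ) (x : M)
    (v : Fin (2 * m + 1) → TangentSpace 𝓘(ℝ, E) x) : ℝ :=
  ∑ σ : Equiv.Perm (Fin (2 * m + 1)), ((Equiv.Perm.sign σ : ℤ) : ℝ) *
    (η x (v (σ 0)) * ∏ i : Fin m,
      extDeriv1 η x (v (σ ⟨2 * i.1 + 1, by omega⟩)) (v (σ ⟨2 * i.1 + 2, by omega⟩)))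

/-- The Nijenhuis torsion
`[φ,φ](X,Y) = φ²[X,Y] + [φX,φY] - φ[φX,Y] - φ[X,φY]` of a (1,1)-tensor field `φ`. -/
def nijenhuis (φ : Π x : M, TangentSpace 𝓘(ℝ, E) x →L[ℝ] TangentSpace 𝓘(ℝ, E) x)
    (X Y : VField E M) (x : M) : TangentSpace 𝓘(ℝ, E) x :=
  φ x (φ x (mlieBracket 𝓘(ℝ, E) X Y x))
    + mlieBracket 𝓘(ℝ, E) (fun y ↦ φ y (X y)) (fun y ↦ φ y (Y y)) x
    - φ x (mlieBracket 𝓘(ℝ, E) (fun y ↦ φ y (X y)) Y x)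
    - φ x (mlieBracket 𝓘(ℝ, E) X (fun y ↦ φ y (Y y)) x)

/-- Normality `[φ,φ] + 2 dη ⊗ ξ = 0`. A contact metric structure is Sasakian iff it is normal,
i.e. iff the almost complex structure `J X = φ X + η(X) r ∂_r`, `J (r ∂_r) = -ξ` on the metric
cone `M × (0,∞)` is integrable. -/
def IsNormal (η : Π x : M, TangentSpace 𝓘(ℝ, E) x →L[ℝ] ℝ) (ξ : VField E M)
    (φ : Π x : M, TangentSpace 𝓘(ℝ, E) x →L[ℝ] TangentSpace 𝓘(ℝ, E) x) : Prop :=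
  ∀ (x : M) (X Y : VField E M), MDiffAt (T% X) x → MDiffAt (T% Y) x →
    nijenhuis φ X Y x + (2 * extDeriv1 η x (X x) (Y x)) • ξ x = 0

variable [RiemannianBundle (fun x : M ↦ TangentSpace 𝓘(ℝ, E) x)]

/-- `(φ, ξ, η)` together with the Riemannian metric of `M` is a contact metric (contact
Riemannian) structure on the `(2m+1)`-dimensional manifold `M`. -/
structure IsContactMetric (m : ℕ) (η : Π x : M, TangentSpace 𝓘(ℝ, E) x →L[ℝ] ℝ)
    (ξ : VField E M)
    (φ : Π x : M, TangentSpace 𝓘(ℝ, E) x →L[ℝ] TangentSpace 𝓘(ℝ, E) x) : Prop where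
  dim : finrank ℝ E = 2 * m + 1
  smooth_eta : ContMDiff 𝓘(ℝ, E) (𝓘(ℝ, E).prod 𝓘(ℝ, E →L[ℝ] ℝ)) ∞
    (fun x ↦ TotalSpace.mk' (E →L[ℝ] ℝ)
      (E := fun x : M ↦ TangentSpace 𝓘(ℝ, E) x →L[ℝ] Bundle.Trivial M ℝ x) x (η x))
  smooth_xi : ContMDiff 𝓘(ℝ, E) (𝓘(ℝ, E).prod 𝓘(ℝ, E)) ∞ (T% ξ)
  smooth_phi : ContMDiff 𝓘(ℝ, E) (𝓘(ℝ, E).prod 𝓘(ℝ, E →L[ℝ] E)) ∞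
    (fun x ↦ TotalSpace.mk' (E →L[ℝ] E)
      (E := fun x : M ↦ TangentSpace 𝓘(ℝ, E) x →L[ℝ] TangentSpace 𝓘(ℝ, E) x) x (φ x))
  /-- `η ∧ (dη)^m` vanishes nowhere. -/
  contact : ∀ x : M, ∃ v, contactVolume m η x v ≠ 0
  eta_xi : ∀ x : M, η x (ξ x) = 1
  reeb : ∀ (x : M) (v : TangentSpace 𝓘(ℝ, E) x), extDeriv1 η x (ξ x) v = 0
  deta_eq : ∀ (x : M) (u v : TangentSpace 𝓘(ℝ, E) x), extDeriv1 η x u v = inner ℝ u (φ x v)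
  eta_eq : ∀ (x : M) (u : TangentSpace 𝓘(ℝ, E) x), η x u = inner ℝ (ξ x) u
  phi_sq : ∀ (x : M) (u : TangentSpace 𝓘(ℝ, E) x), φ x (φ x u) = -u + η x u • ξ x

/-- `ξ` is a Killing field: `(L_ξ g)(X,Y) = ξ(g(X,Y)) - g([ξ,X],Y) - g(X,[ξ,Y]) = 0`. -/
def IsKilling (ξ : VField E M) : Prop :=
  ∀ (x : M) (X Y : VField E M), MDiffAt (T% X) x → MDiffAt (T% Y) x →
    mvfderiv 𝓘(ℝ, E) (fun y ↦ inner ℝ (X y) (Y y)) x (ξ x)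
      - inner ℝ (mlieBracket 𝓘(ℝ, E) ξ X x) (Y x) - inner ℝ (X x) (mlieBracket 𝓘(ℝ, E) ξ Y x) = 0

/-- A K-contact structure: a contact metric structure whose Reeb field is Killing. -/
structure IsKContact (m : ℕ) (η : Π x : M, TangentSpace 𝓘(ℝ, E) x →L[ℝ] ℝ)
    (ξ : VField E M)
    (φ : Π x : M, TangentSpace 𝓘(ℝ, E) x →L[ℝ] TangentSpace 𝓘(ℝ, E) x) : Prop
    extends IsContactMetric m η ξ φ where
  killing : IsKilling ξ

/-- A Sasakian structure: a normal contact metric structure. -/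
structure IsSasakian (m : ℕ) (η : Π x : M, TangentSpace 𝓘(ℝ, E) x →L[ℝ] ℝ)
    (ξ : VField E M)
    (φ : Π x : M, TangentSpace 𝓘(ℝ, E) x →L[ℝ] TangentSpace 𝓘(ℝ, E) x) : Prop
    extends IsContactMetric m η ξ φ where
  normal : IsNormal η ξ φ

variable [IsContMDiffRiemannianBundle 𝓘(ℝ, E) ∞ E (fun x : M ↦ TangentSpace 𝓘(ℝ, E) x)]

/-- `Ric = a g + b η ⊗ η` for some smooth functions `a`, `b`. -/
def IsEtaEinstein (η : Π x : M, TangentSpace 𝓘(ℝ, E) x →L[ℝ] ℝ) : Prop :=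
  ∃ a b : M → ℝ, ContMDiff 𝓘(ℝ, E) 𝓘(ℝ, ℝ) ∞ a ∧ ContMDiff 𝓘(ℝ, E) 𝓘(ℝ, ℝ) ∞ b ∧
    ∀ (x : M) (u v : TangentSpace 𝓘(ℝ, E) x),
      ricci x u v = a x * inner ℝ u v + b x * (η x u * η x v)

/-- `M` is quasi-Einstein with respect to the unit vector field `U`: `Ric = a g + b u ⊗ u` for
some smooth functions `a`, `b`, where `u = g(U, ·)`. -/
def IsQuasiEinstein (U : VField E M) : Prop :=
  (∀ x, inner ℝ (U x) (U x) = (1 : ℝ)) ∧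
  ∃ a b : M → ℝ, ContMDiff 𝓘(ℝ, E) 𝓘(ℝ, ℝ) ∞ a ∧ ContMDiff 𝓘(ℝ, E) 𝓘(ℝ, ℝ) ∞ b ∧
    ∀ (x : M) (v w : TangentSpace 𝓘(ℝ, E) x),
      ricci x v w = a x * inner ℝ v w + b x * (inner ℝ (U x) v * inner ℝ (U x) w)

end ContactGeometry

end ContactMetricGeometry

/-! On a K-contact manifold the curvature in the direction of ξ is controlled by φ. Since ξ is
Killing, ∇ξ is skew, and comparison with dη gives ∇_X ξ = -φX (`covDeriv_xi`). Hence R(X,Y)ξ = (∇_Y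
φ)X - (∇_X φ)Y, and the first Bianchi identity inverts this to (∇_X φ)Y = R(ξ,X)Y
(`covDerivPhi_eq_riemann`). Differentiating φξ = 0 yields R(X,ξ)ξ = X - η(X)ξ. Differentiating φ² =
-I + η⊗ξ and taking a trace yields Ric(ξ,φ·) = 0, so Ric(ξ,·) = (n-1)η (`ricci_xi`).

In W(X,ξ)ξ every term except Ric(X,·) is then explicit, so its vanishing says exactly that Ric =
(r/(n-1) - 1) g + (n - r/(n-1)) η⊗η (`weyl_xi_xi_eq_zero_iff`). The coefficients are smooth because
r is. Conversely, if Ric = a g + b η⊗η, then a + b = n - 1 and r = na + b force these same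
coefficients.

If W(X,Y)ξ = 0 for all X, Y, this Ricci tensor can be substituted back. The scalar curvature cancels
and R(X,Y)ξ = η(Y)X - η(X)Y remains (`riemann_xi_of_weyl`). By pair symmetry (∇_X φ)Y = g(X,Y)ξ -
η(Y)X, and the Nijenhuis torsion, written through ∇φ, equals -2dη⊗ξ (`isSasakian_of_riemann_xi`).

The curvature is defined through particular extensions of tangent vectors, so its tensoriality, its
symmetries and the smoothness of r are established beforehand. -/

set_option linter.unusedSectionVars false

/-! ### Germs of smooth functions and vector fields; second-order Lie bracket identities -/

noncomputable section SmoothFields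

namespace ContactGeometry

open Filter

variable {E : Type*} [NormedAddCommGroup E] [NormedSpace ℝ E]
  {M : Type*} [TopologicalSpace M] [ChartedSpace E M]

/-- A function that is smooth on a neighbourhood of `x`. -/
def SmoothFunNear (E : Type*) [NormedAddCommGroup E] [NormedSpace ℝ E]
    {M : Type*} [TopologicalSpace M] [ChartedSpace E M] (f : M → ℝ) (x : M) : Prop :=
  ∀ᶠ y in 𝓝 x, ContMDiffAt 𝓘(ℝ, E) 𝓘(ℝ, ℝ) ∞ f y

variable {f g : M → ℝ} {x : M}

lemma SmoothFunNear.eventually (h : SmoothFunNear E f x) : ∀ᶠ y in 𝓝 x, SmoothFunNear E f y :=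
  eventually_eventually_nhds.2 h

lemma SmoothFunNear.mdiffAt (h : SmoothFunNear E f x) : MDiffAt f x :=
  h.self_of_nhds.mdifferentiableAt (by simp)

lemma SmoothFunNear.congr (h : SmoothFunNear E f x) (e : ∀ᶠ y in 𝓝 x, g y = f y) :
    SmoothFunNear E g x := by
  filter_upwards [h, eventually_eventually_nhds.2 e] with y hy ey
  exact hy.congr_of_eventuallyEq ey

lemma SmoothFunNear.add (hf : SmoothFunNear E f x) (hg : SmoothFunNear E g x) :
    SmoothFunNear E (fun y ↦ f y + g y) x := by
  filter_upwards [hf, hg] with y h1 h2 using ContMDiffAt.add h1 h2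

lemma SmoothFunNear.sub (hf : SmoothFunNear E f x) (hg : SmoothFunNear E g x) :
    SmoothFunNear E (fun y ↦ f y - g y) x := by
  filter_upwards [hf, hg] with y h1 h2 using ContMDiffAt.sub h1 h2

lemma SmoothFunNear.const_mul (c : ℝ) (hf : SmoothFunNear E f x) :
    SmoothFunNear E (fun y ↦ c * f y) x := by
  filter_upwards [hf] with y h1 using contMDiffAt_const.mul h1

lemma SmoothFunNear.sum {ι : Type*} {s : Finset ι} {F : ι → M → ℝ}
    (h : ∀ i ∈ s, SmoothFunNear E (F i) x) : SmoothFunNear E (fun y ↦ ∑ i ∈ s, F i y) x := by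
  filter_upwards [(Finset.eventually_all s).2 h] with y hy
  exact ContMDiffAt.sum hy

lemma mlieBracket_congr_right {X Y Z : VField E M} (h : ∀ᶠ y in 𝓝 x, Y y = Z y) :
    VectorField.mlieBracket 𝓘(ℝ, E) X Y x = VectorField.mlieBracket 𝓘(ℝ, E) X Z x :=
  (EventuallyEq.refl _ X).mlieBracket_vectorField_eq h

variable [IsManifold 𝓘(ℝ, E) ∞ M]

/-- A vector field that is smooth on a neighbourhood of `x`. -/
def SmoothNear (X : VField E M) (x : M) : Prop :=
  ∀ᶠ y in 𝓝 x, ContMDiffAt 𝓘(ℝ, E) (𝓘(ℝ, E).prod 𝓘(ℝ, E)) ∞ (T% X) y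

/-- Supplies the manifold instance in the form that the Lie bracket lemmas ask for. -/
lemma isManifold_minSmoothness (k : ℕ) : IsManifold 𝓘(ℝ, E) (minSmoothness ℝ k) M :=
  IsManifold.of_le (n := ∞) (by simp; exact_mod_cast le_top)

variable {X Y Z W : VField E M}

lemma SmoothNear.eventually (h : SmoothNear X x) : ∀ᶠ y in 𝓝 x, SmoothNear X y :=
  eventually_eventually_nhds.2 h

lemma SmoothNear.mdiffAt (h : SmoothNear X x) : MDiffAt (T% X) x :=
  h.self_of_nhds.mdifferentiableAt (by simp)

lemma SmoothNear.congr (h : SmoothNear X x) (e : ∀ᶠ y in 𝓝 x, Y y = X y) : SmoothNear Y x := by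
  filter_upwards [h, eventually_eventually_nhds.2 e] with y hy ey
  exact hy.congr_of_eventuallyEq (ey.mono fun z hz ↦ by simp [hz])

lemma SmoothNear.add (hX : SmoothNear X x) (hY : SmoothNear Y x) : SmoothNear (X + Y) x := by
  filter_upwards [hX, hY] with y h1 h2 using h1.add_section h2

lemma SmoothNear.sub (hX : SmoothNear X x) (hY : SmoothNear Y x) : SmoothNear (X - Y) x := by
  filter_upwards [hX, hY] with y h1 h2 using h1.sub_section h2

lemma SmoothNear.smul (hf : SmoothFunNear E f x) (hX : SmoothNear X x) :
    SmoothNear (f • X) x := by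
  filter_upwards [hf, hX] with y h1 h2 using h1.smul_section h2

lemma SmoothNear.const_smul (c : ℝ) (hX : SmoothNear X x) : SmoothNear (c • X) x := by
  filter_upwards [hX] with y h2 using h2.const_smul_section

lemma SmoothNear.sum {ι : Type*} {s : Finset ι} {V : ι → VField E M}
    (h : ∀ i ∈ s, SmoothNear (V i) x) : SmoothNear (fun y ↦ ∑ i ∈ s, V i y) x := by
  filter_upwards [(Finset.eventually_all s).2 h] with y hy
  exact ContMDiffAt.sum_section hy

lemma smoothNear_extend {x : M} (v : TangentSpace 𝓘(ℝ, E) x) :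
    SmoothNear (extend E v : VField E M) x := by
  obtain ⟨s, hs, h⟩ := exists_contMDiffOn_extend (k := ∞) 𝓘(ℝ, E) E v
  filter_upwards [eventually_mem_nhds_iff.2 hs] with y hy
  exact h.contMDiffAt hy

/-- The differential df is a smooth section of the cotangent bundle, checked in bundle coordinates,
and is then paired with X. -/
lemma smoothFunNear_mvfderiv (hf : SmoothFunNear E f x) (hX : SmoothNear X x) :
    SmoothFunNear E (fun y ↦ mvfderiv 𝓘(ℝ, E) f y (X y)) x := by
  filter_upwards [hf, hX] with y hfy hXy
  have h1 := hfy.mfderiv_const (m := ∞) (by simp)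
  have h2 : ContMDiffAt 𝓘(ℝ, E) (𝓘(ℝ, E).prod 𝓘(ℝ, E →L[ℝ] ℝ)) ∞
      (fun z ↦ TotalSpace.mk' (E →L[ℝ] ℝ)
        (E := fun x : M ↦ TangentSpace 𝓘(ℝ, E) x →L[ℝ] Bundle.Trivial M ℝ x) z
        (mvfderiv 𝓘(ℝ, E) f z)) y := by
    rw [contMDiffAt_hom_bundle]
    refine ⟨contMDiffAt_id, ?_⟩
    refine h1.congr_of_eventuallyEq (Eventually.of_forall fun z ↦ ?_)
    simp only [inTangentCoordinates, ContinuousLinearMap.inCoordinates]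
    ext v
    simp [mvfderiv]
    rfl
  have h3 := h2.clm_bundle_apply (v := X) hXy
  rw [contMDiffAt_totalSpace] at h3
  exact h3.2

lemma SmoothNear.mlieBracket [CompleteSpace E] (hX : SmoothNear X x) (hY : SmoothNear Y x) :
    SmoothNear (mlieBracket 𝓘(ℝ, E) X Y) x := by
  have := isManifold_minSmoothness (E := E) (M := M) 3
  have : IsManifold 𝓘(ℝ, E) (((⊤ : ℕ∞) : WithTop ℕ∞) + 1) M := by
    simpa using! inferInstanceAs (IsManifold 𝓘(ℝ, E) ∞ M)
  filter_upwards [hX, hY] with y h1 h2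
  exact ContMDiffAt.mlieBracket_vectorField (m := ⊤) (n := ⊤) h1 h2 (by simp)

lemma mlieBracket_smul_right_eventually [CompleteSpace E] (hf : SmoothFunNear E f x)
    (hZ : SmoothNear Z x) :
    ∀ᶠ y in 𝓝 x, VectorField.mlieBracket 𝓘(ℝ, E) X (f • Z) y =
      ((fun y ↦ mvfderiv 𝓘(ℝ, E) f y (X y)) • Z
        + f • VectorField.mlieBracket 𝓘(ℝ, E) X Z) y := by
  have := isManifold_minSmoothness (E := E) (M := M) 2
  filter_upwards [hZ.eventually, hf.eventually] with y h1 h2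
  simpa using! mlieBracket_smul_right h2.mdiffAt h1.mdiffAt

/-- The second-order Leibniz rule, from which `mvfderiv_mlieBracket` extracts the action of a
commutator on functions. -/
lemma mlieBracket_mlieBracket_smul [CompleteSpace E] (hf : SmoothFunNear E f x)
    (hY : SmoothNear Y x) (hZ : SmoothNear Z x) :
    VectorField.mlieBracket 𝓘(ℝ, E) X (VectorField.mlieBracket 𝓘(ℝ, E) Y (f • Z)) x =
      mvfderiv 𝓘(ℝ, E) (fun y ↦ mvfderiv 𝓘(ℝ, E) f y (Y y)) x (X x) • Z x
        + mvfderiv 𝓘(ℝ, E) f x (Y x) • VectorField.mlieBracket 𝓘(ℝ, E) X Z x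
        + (mvfderiv 𝓘(ℝ, E) f x (X x) • VectorField.mlieBracket 𝓘(ℝ, E) Y Z x
          + f x • VectorField.mlieBracket 𝓘(ℝ, E) X (VectorField.mlieBracket 𝓘(ℝ, E) Y Z) x) := by
  have := isManifold_minSmoothness (E := E) (M := M) 2
  rw [mlieBracket_congr_right (mlieBracket_smul_right_eventually hf hZ),
    mlieBracket_add_right (hZ.smul (smoothFunNear_mvfderiv hf hY)).mdiffAt
      ((hY.mlieBracket hZ).smul hf).mdiffAt,
    mlieBracket_smul_right (smoothFunNear_mvfderiv hf hY).mdiffAt hZ.mdiffAt,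
    mlieBracket_smul_right hf.mdiffAt (hY.mlieBracket hZ).mdiffAt]

lemma mlieBracket_jacobi [CompleteSpace E]
    (hX : SmoothNear X x) (hY : SmoothNear Y x) (hZ : SmoothNear Z x) :
    VectorField.mlieBracket 𝓘(ℝ, E) X (VectorField.mlieBracket 𝓘(ℝ, E) Y Z) x =
      VectorField.mlieBracket 𝓘(ℝ, E) (VectorField.mlieBracket 𝓘(ℝ, E) X Y) Z x
        + VectorField.mlieBracket 𝓘(ℝ, E) Y (VectorField.mlieBracket 𝓘(ℝ, E) X Z) x := by
  have := isManifold_minSmoothness (E := E) (M := M) 3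
  have h2 : minSmoothness ℝ 2 ≤ (∞ : WithTop ℕ∞) := by
    simpa using! (mod_cast le_top : ((2 : ℕ∞) : WithTop ℕ∞) ≤ ((⊤ : ℕ∞) : WithTop ℕ∞))
  exact leibniz_identity_mlieBracket_apply (hX.self_of_nhds.of_le h2)
    (hY.self_of_nhds.of_le h2) (hZ.self_of_nhds.of_le h2)

/-- A commutator acts on functions as `[X, Y] f = X (Y f) - Y (X f)`. -/
lemma mvfderiv_mlieBracket [CompleteSpace E] (hX : SmoothNear X x) (hY : SmoothNear Y x)
    (hf : SmoothFunNear E f x) :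
    mvfderiv 𝓘(ℝ, E) f x (VectorField.mlieBracket 𝓘(ℝ, E) X Y x) =
      mvfderiv 𝓘(ℝ, E) (fun y ↦ mvfderiv 𝓘(ℝ, E) f y (Y y)) x (X x)
        - mvfderiv 𝓘(ℝ, E) (fun y ↦ mvfderiv 𝓘(ℝ, E) f y (X y)) x (Y x) := by
  have := isManifold_minSmoothness (E := E) (M := M) 2
  rcases subsingleton_or_nontrivial (TangentSpace 𝓘(ℝ, E) x) with hE | hE
  -- In a zero tangent space all derivatives vanish; otherwise a nonzero vector v is available to
  -- test coefficients.
  · simp [Subsingleton.elim (VectorField.mlieBracket _ X Y x) 0,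
      Subsingleton.elim (X x) 0, Subsingleton.elim (Y x) 0]
  obtain ⟨v, hv⟩ := exists_ne (0 : TangentSpace 𝓘(ℝ, E) x)
  have hZ : SmoothNear (extend E v : VField E M) x := smoothNear_extend _
  -- Compare the Jacobi identity for Z with that for fZ. All that survives is a multiple of Z(x) = v
  -- ≠ 0, whose coefficient is the difference of the two sides.
  have j1 := mlieBracket_jacobi hX hY hZ
  have j2 := mlieBracket_jacobi hX hY (hZ.smul hf)
  rw [mlieBracket_mlieBracket_smul hf hY hZ, mlieBracket_mlieBracket_smul hf hX hZ,
    mlieBracket_smul_right hf.mdiffAt hZ.mdiffAt, j1, extend_apply_self] at j2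
  rw [← sub_eq_zero, ← smul_eq_zero_iff_left hv, ← sub_eq_zero.2 j2.symm]
  module

end ContactGeometry
end SmoothFields

/-! ### Smooth orthonormal frames and smoothness of the Levi-Civita connection -/

noncomputable section LeviCivitaSmooth

namespace ContactGeometry

open Filter InnerProductSpace

variable {E : Type*} [NormedAddCommGroup E] [NormedSpace ℝ E] [FiniteDimensional ℝ E]
  {M : Type*} [TopologicalSpace M] [ChartedSpace E M] [IsManifold 𝓘(ℝ, E) ∞ M]
  [RiemannianBundle (fun x : M ↦ TangentSpace 𝓘(ℝ, E) x)]
  [IsContMDiffRiemannianBundle 𝓘(ℝ, E) ∞ E (fun x : M ↦ TangentSpace 𝓘(ℝ, E) x)]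
  {X Y Z W : VField E M} {f : M → ℝ} {x : M}

lemma SmoothNear.inner (hX : SmoothNear X x) (hY : SmoothNear Y x) :
    SmoothFunNear E (fun y ↦ (inner ℝ (X y) (Y y) : ℝ)) x := by
  filter_upwards [hX, hY] with y h1 h2
  exact ContMDiffAt.inner_bundle (IB := 𝓘(ℝ, E)) (F := E)
    (E := fun x : M ↦ TangentSpace 𝓘(ℝ, E) x) (b := fun y ↦ y) h1 h2

/-- By strong induction: each step subtracts projections whose coefficients are quotients of smooth
functions, with denominators nonzero by linear independence. -/
lemma smoothNear_gramSchmidt {n : ℕ} {s : Fin n → VField E M} (hs : ∀ i, SmoothNear (s i) x)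
    (hli : ∀ᶠ y in 𝓝 x, LinearIndependent ℝ (fun i ↦ s i y)) (i : Fin n) :
    SmoothNear (fun y ↦ gramSchmidt ℝ (fun i ↦ s i y) i) x := by
  induction i using WellFoundedLT.induction with
  | ind i ih =>
    have hsum : SmoothNear (fun y ↦ ∑ j ∈ Finset.Iio i,
        ((fun y ↦ (inner ℝ (gramSchmidt ℝ (fun i ↦ s i y) j) (s i y) : ℝ)
          / inner ℝ (gramSchmidt ℝ (fun i ↦ s i y) j) (gramSchmidt ℝ (fun i ↦ s i y) j))
          • (fun y ↦ gramSchmidt ℝ (fun i ↦ s i y) j : VField E M)) y) x := by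
      refine SmoothNear.sum fun j hj ↦ ?_
      have hj := ih j (Finset.mem_Iio.1 hj)
      refine hj.smul ?_
      filter_upwards [hj.inner (hs i), hj.inner hj, hli] with y h1 h2 h3
      exact h1.div₀ h2 (inner_self_ne_zero.2 (gramSchmidt_ne_zero j h3))
    refine ((hs i).sub hsum).congr (Eventually.of_forall fun y ↦ ?_)
    rw [gramSchmidt_def]
    simp [Submodule.starProjection_singleton]

/-- Near every point there is a smooth orthonormal frame. -/
lemma exists_orthonormal_frame (x : M) :
    ∃ e : Fin (finrank ℝ E) → VField E M, (∀ i, SmoothNear (e i) x) ∧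
      ∀ᶠ y in 𝓝 x, Orthonormal ℝ (fun i ↦ e i y) := by
  set t := trivializationAt E (fun x : M ↦ TangentSpace 𝓘(ℝ, E) x) x
  have hx : x ∈ t.baseSet := mem_baseSet_trivializationAt' x
  have hb : ∀ᶠ y in 𝓝 x, y ∈ t.baseSet := t.open_baseSet.mem_nhds hx
  set s := t.localFrame (finBasis ℝ E)
  have hs (i) : SmoothNear (s i) x := by
    filter_upwards [hb] with y hy
    exact contMDiffAt_localFrame_of_mem ∞ _ _ i hy
  have hli : ∀ᶠ y in 𝓝 x, LinearIndependent ℝ (fun i ↦ s i y) := by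
    filter_upwards [hb] with y hy
    exact (t.isLocalFrameOn_localFrame_baseSet 𝓘(ℝ, E) ∞ (finBasis ℝ E)).linearIndependent hy
  refine ⟨fun i y ↦ gramSchmidtNormed ℝ (fun i ↦ s i y) i, fun i ↦ ?_, ?_⟩
  · have hg := smoothNear_gramSchmidt hs hli i
    refine hg.smul (f := fun y ↦ ‖gramSchmidt ℝ (fun i ↦ s i y) i‖⁻¹) ?_
    filter_upwards [hg.inner hg, hli] with y h1 h2
    have h0 := gramSchmidt_ne_zero i h2
    -- The square root is smooth away from 0, so normalizing a nonvanishing field preserves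
    -- smoothness.
    have h3 := ((Real.contDiffAt_sqrt (n := ∞) (inner_self_ne_zero.2 h0)).contMDiffAt.comp y h1)
    simp only [Function.comp_def, ← norm_eq_sqrt_real_inner] at h3
    exact h3.inv₀ (norm_ne_zero_iff.2 h0)
  · filter_upwards [hli] with y hy using gramSchmidtNormed_orthonormal hy

lemma sum_inner_smul_of_orthonormal {e : Fin (finrank ℝ E) → TangentSpace 𝓘(ℝ, E) x}
    (he : Orthonormal ℝ e) (v : TangentSpace 𝓘(ℝ, E) x) :
    ∑ i, (inner ℝ (e i) v : ℝ) • e i = v := by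
  have hc : Fintype.card (Fin (finrank ℝ E)) = finrank ℝ (TangentSpace 𝓘(ℝ, E) x) := by
    rw [Fintype.card_fin]; rfl
  have h := he.linearIndependent.span_eq_top_of_card_eq_finrank' hc
  simpa using! (OrthonormalBasis.mk he h.ge).sum_repr' v

/-- A field is the sum of its frame coefficients times the frame, so smoothness can be tested on
inner products, which is what the Koszul formula provides. -/
lemma smoothNear_of_inner {e : Fin (finrank ℝ E) → VField E M} (he : ∀ i, SmoothNear (e i) x)
    (ho : ∀ᶠ y in 𝓝 x, Orthonormal ℝ (fun i ↦ e i y))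
    (h : ∀ i, SmoothFunNear E (fun y ↦ (inner ℝ (e i y) (X y) : ℝ)) x) : SmoothNear X x := by
  have := SmoothNear.sum (s := Finset.univ) fun i _ ↦ (he i).smul (h i)
  refine this.congr ?_
  filter_upwards [ho] with y hy
  exact (sum_inner_smul_of_orthonormal hy (X y)).symm

/-- `∇_X Y` as a vector field. -/
def covDeriv (X Y : VField E M) : VField E M := fun y ↦ leviCivita E M Y y (X y)

lemma SmoothNear.koszul (hX : SmoothNear X x) (hY : SmoothNear Y x) (hZ : SmoothNear Z x) :
    SmoothFunNear E (fun y ↦ koszul X Y Z y) x := by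
  unfold ContactGeometry.koszul
  refine .const_mul _ (.add (.sub (.add (.sub (.add ?_ ?_) ?_) ?_) ?_) ?_)
  · exact smoothFunNear_mvfderiv (hY.inner hZ) hX
  · exact smoothFunNear_mvfderiv (hZ.inner hX) hY
  · exact smoothFunNear_mvfderiv (hX.inner hY) hZ
  · exact (hX.mlieBracket hY).inner hZ
  · exact (hY.mlieBracket hZ).inner hX
  · exact (hZ.mlieBracket hX).inner hY

/-- The Levi-Civita connection preserves smoothness. -/
lemma SmoothNear.covDeriv (hX : SmoothNear X x) (hY : SmoothNear Y x) :
    SmoothNear (covDeriv X Y) x := by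
  obtain ⟨e, he, ho⟩ := exists_orthonormal_frame (E := E) x
  refine smoothNear_of_inner he ho fun i ↦ (hX.koszul hY (he i)).congr ?_
  filter_upwards [hX.eventually, hY.eventually, (he i).eventually] with y h1 h2 h3
  rw [real_inner_comm]
  exact inner_leviCivita h1.mdiffAt h2.mdiffAt h3.mdiffAt

end ContactGeometry
end LeviCivitaSmooth

/-! ### Tensoriality and symmetries of the curvature -/

noncomputable section CurvatureTensor

namespace ContactGeometry

open Filter InnerProductSpace

variable {E : Type*} [NormedAddCommGroup E] [NormedSpace ℝ E] [FiniteDimensional ℝ E]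
  {M : Type*} [TopologicalSpace M] [ChartedSpace E M] [IsManifold 𝓘(ℝ, E) ∞ M]
  [RiemannianBundle (fun x : M ↦ TangentSpace 𝓘(ℝ, E) x)]
  [IsContMDiffRiemannianBundle 𝓘(ℝ, E) ∞ E (fun x : M ↦ TangentSpace 𝓘(ℝ, E) x)]
  {X X' Y Z Z' W : VField E M} {f : M → ℝ} {x : M}

/-- `Φ` is linear over germs of smooth functions on germs of smooth vector fields at `x`. -/
structure SmoothTensorialAt {A : Type*} [AddCommGroup A] [Module ℝ A]
    (Φ : VField E M → A) (x : M) : Prop where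
  smul : ∀ {f : M → ℝ} {X : VField E M}, SmoothFunNear E f x → SmoothNear X x →
    Φ (f • X) = f x • Φ X
  add : ∀ {X Y : VField E M}, SmoothNear X x → SmoothNear Y x → Φ (X + Y) = Φ X + Φ Y

namespace SmoothTensorialAt

variable {A : Type*} [AddCommGroup A] [Module ℝ A] {Φ : VField E M → A}

/-- Multiply by the indicator ψ of {X = Y}: it is 1 near x, hence smooth there, and ψX = ψY
everywhere. No bump function is needed, since only germs must be smooth. -/
lemma congr_eventually (h : SmoothTensorialAt Φ x) (hX : SmoothNear X x) (hY : SmoothNear Y x)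
    (e : ∀ᶠ y in 𝓝 x, X y = Y y) : Φ X = Φ Y := by
  classical
  let ψ (y : M) : ℝ := if X y = Y y then 1 else 0
  have hψ : SmoothFunNear E ψ x := by
    have h1 : SmoothFunNear E (fun _ : M ↦ (1 : ℝ)) x :=
      Eventually.of_forall fun y ↦ contMDiffAt_const
    exact h1.congr (e.mono fun y hy ↦ by simp [ψ, hy])
  have hψx : ψ x = 1 := by simp [ψ, e.self_of_nhds]
  have hXY : ψ • X = ψ • Y := by
    funext y
    by_cases hy : X y = Y y <;> simp [ψ, hy]
  have h1 := h.smul hψ hX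
  rw [hXY, h.smul hψ hY, hψx, one_smul, one_smul] at h1
  exact h1.symm

lemma sum (h : SmoothTensorialAt Φ x) {ι : Type*} {s : Finset ι} {V : ι → VField E M}
    (hV : ∀ i ∈ s, SmoothNear (V i) x) : Φ (fun y ↦ ∑ i ∈ s, V i y) = ∑ i ∈ s, Φ (V i) := by
  classical
  induction s using Finset.induction_on with
  | empty =>
    have h0 : SmoothNear (0 : VField E M) x := by
      simpa using! (smoothNear_extend (0 : TangentSpace 𝓘(ℝ, E) x)).const_smul 0
    simpa using! h.add h0 h0
  | insert a s ha ih =>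
    simp only [Finset.mem_insert, forall_eq_or_imp] at hV
    simp only [Finset.sum_insert ha, ← ih hV.2]
    exact h.add hV.1 (SmoothNear.sum hV.2)

/-- A tensorial operation depends only on the value of the vector field at the point. -/
lemma pointwise (h : SmoothTensorialAt Φ x) (hX : SmoothNear X x) (hY : SmoothNear Y x)
    (e : X x = Y x) : Φ X = Φ Y := by
  obtain ⟨s, hs, ho⟩ := exists_orthonormal_frame (E := E) x
  -- Expanding V in a smooth frame turns the value of Φ into an expression in V(x) alone.
  have key {V : VField E M} (hV : SmoothNear V x) :
      Φ V = ∑ i, (inner ℝ (s i x) (V x) : ℝ) • Φ (s i) := by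
    have hi (i) := ((hs i).smul ((hs i).inner hV))
    rw [h.congr_eventually hV (SmoothNear.sum (s := Finset.univ) fun i _ ↦ hi i) ?_,
      h.sum fun i _ ↦ hi i]
    · exact Finset.sum_congr rfl fun i _ ↦ h.smul ((hs i).inner hV) (hs i)
    · filter_upwards [ho] with y hy
      exact (sum_inner_smul_of_orthonormal hy (V y)).symm
  rw [key hX, key hY, e]

end SmoothTensorialAt

/-! ### Calculus of the Levi-Civita connection -/

lemma covDeriv_add_left : covDeriv (X + X') Y = covDeriv X Y + covDeriv X' Y := by
  funext y; simp [covDeriv]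

lemma covDeriv_smul_left : covDeriv (f • X) Y = f • covDeriv X Y := by
  funext y; simp [covDeriv]

lemma covDeriv_neg_left : covDeriv (-X) Y = -covDeriv X Y := by
  funext y; simp [covDeriv]

lemma covDeriv_add_right (hY : MDiffAt (T% Y) x) (hZ : MDiffAt (T% Z) x) :
    covDeriv X (Y + Z) x = covDeriv X Y x + covDeriv X Z x := by
  simp [covDeriv, (leviCivita E M).isCovariantDerivativeOnUniv.add hY hZ]

lemma covDeriv_smul_right (hf : MDiffAt f x) (hY : MDiffAt (T% Y) x) :
    covDeriv X (f • Y) x = f x • covDeriv X Y x + mvfderiv 𝓘(ℝ, E) f x (X x) • Y x := by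
  simp [covDeriv, (leviCivita E M).isCovariantDerivativeOnUniv.leibniz hY hf]

lemma covDeriv_neg_right (hY : MDiffAt (T% Y) x) : covDeriv X (-Y) x = -covDeriv X Y x := by
  have := (leviCivita E M).isCovariantDerivativeOnUniv.smul_const (-1) hY
  simp only [neg_smul, one_smul] at this
  simp [covDeriv, this]

lemma covDeriv_congr_right (hY : MDiffAt (T% Y) x) (hZ : MDiffAt (T% Z) x)
    (e : ∀ᶠ y in 𝓝 x, Y y = Z y) : covDeriv X Y x = covDeriv X Z x := by
  simp only [covDeriv]
  rw [(leviCivita E M).isCovariantDerivativeOnUniv.congr_of_eventuallyEq hY hZ univ_mem e]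

lemma covDeriv_sub_covDeriv (hX : MDiffAt (T% X) x) (hY : MDiffAt (T% Y) x) :
    covDeriv X Y x - covDeriv Y X x = mlieBracket 𝓘(ℝ, E) X Y x :=
  (CovariantDerivative.torsion_eq_zero_iff _).1 leviCivita_torsion hX hY

lemma mvfderiv_inner (hX : MDiffAt (T% X) x) (hY : MDiffAt (T% Y) x) (hZ : MDiffAt (T% Z) x) :
    mvfderiv 𝓘(ℝ, E) (fun y ↦ (inner ℝ (Y y) (Z y) : ℝ)) x (X x) =
      inner ℝ (covDeriv X Y x) (Z x) + inner ℝ (Y x) (covDeriv X Z x) :=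
  leviCivita_metric hX hY hZ

lemma curvatureField_eq (X Y Z : VField E M) (x : M) :
    curvatureField X Y Z x = covDeriv X (covDeriv Y Z) x - covDeriv Y (covDeriv X Z) x
      - covDeriv (mlieBracket 𝓘(ℝ, E) X Y) Z x := rfl

lemma curvatureField_swap (X Y Z : VField E M) (x : M) :
    curvatureField X Y Z x = -curvatureField Y X Z x := by
  rw [curvatureField_eq, curvatureField_eq, mlieBracket_swap (V := X) (W := Y), covDeriv_neg_left,
    Pi.neg_apply]
  abel

/-- The derivative of f arising in ∇_Y(f ∇_X Z) cancels the one arising in [fX,Y]. -/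
lemma curvatureField_tensorial_left (hZ : SmoothNear Z x) :
    SmoothTensorialAt (fun X : VField E M ↦ curvatureField X Y Z x) x where
  smul {f X} hf hX := by
    have := isManifold_minSmoothness (E := E) (M := M) 2
    simp only [curvatureField_eq, covDeriv_smul_left, Pi.smul_apply', covDeriv_smul_right hf.mdiffAt
      (hX.covDeriv hZ).mdiffAt]
    simp only [covDeriv, mlieBracket_smul_left hf.mdiffAt hX.mdiffAt, map_add, map_smul]
    module
  add {X X'} hX hX' := by
    have := isManifold_minSmoothness (E := E) (M := M) 2
    simp only [curvatureField_eq, covDeriv_add_left, Pi.add_apply, covDeriv_add_right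
      (hX.covDeriv hZ).mdiffAt (hX'.covDeriv hZ).mdiffAt]
    simp only [covDeriv, mlieBracket_add_left hX.mdiffAt hX'.mdiffAt, map_add]
    module

lemma curvatureField_tensorial_mid (hZ : SmoothNear Z x) :
    SmoothTensorialAt (fun Y : VField E M ↦ curvatureField X Y Z x) x where
  smul hf hY := by
    simp only [curvatureField_swap X, (curvatureField_tensorial_left hZ).smul hf hY, smul_neg]
  add hY hY' := by
    simp only [curvatureField_swap X, (curvatureField_tensorial_left hZ).add hY hY', neg_add]

lemma covDeriv_covDeriv_smul (hf : SmoothFunNear E f x) (hY : SmoothNear Y x) (hZ : SmoothNear Z x) :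
    covDeriv X (covDeriv Y (f • Z)) x = f x • covDeriv X (covDeriv Y Z) x
      + mvfderiv 𝓘(ℝ, E) f x (X x) • covDeriv Y Z x
      + (mvfderiv 𝓘(ℝ, E) f x (Y x) • covDeriv X Z x
        + mvfderiv 𝓘(ℝ, E) (fun y ↦ mvfderiv 𝓘(ℝ, E) f y (Y y)) x (X x) • Z x) := by
  have hYZ := hY.covDeriv hZ
  have hYf := smoothFunNear_mvfderiv hf hY
  have e : ∀ᶠ y in 𝓝 x, covDeriv Y (f • Z) y =
      (f • covDeriv Y Z + (fun y ↦ mvfderiv 𝓘(ℝ, E) f y (Y y)) • Z) y := by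
    filter_upwards [hf.eventually, hZ.eventually] with y h1 h2
    exact covDeriv_smul_right h1.mdiffAt h2.mdiffAt
  rw [covDeriv_congr_right (hY.covDeriv (hZ.smul hf)).mdiffAt
    ((hYZ.smul hf).add (hZ.smul hYf)).mdiffAt e,
    covDeriv_add_right (hYZ.smul hf).mdiffAt (hZ.smul hYf).mdiffAt,
    covDeriv_smul_right hf.mdiffAt hYZ.mdiffAt, covDeriv_smul_right hYf.mdiffAt hZ.mdiffAt]

lemma covDeriv_covDeriv_add (hY : SmoothNear Y x) (hZ : SmoothNear Z x) (hZ' : SmoothNear Z' x) :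
    covDeriv X (covDeriv Y (Z + Z')) x =
      covDeriv X (covDeriv Y Z) x + covDeriv X (covDeriv Y Z') x := by
  have e : ∀ᶠ y in 𝓝 x, covDeriv Y (Z + Z') y = (covDeriv Y Z + covDeriv Y Z') y := by
    filter_upwards [hZ.eventually, hZ'.eventually] with y h1 h2
    exact covDeriv_add_right h1.mdiffAt h2.mdiffAt
  rw [covDeriv_congr_right (hY.covDeriv (hZ.add hZ')).mdiffAt
    ((hY.covDeriv hZ).add (hY.covDeriv hZ')).mdiffAt e,
    covDeriv_add_right (hY.covDeriv hZ).mdiffAt (hY.covDeriv hZ').mdiffAt]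

/-- The mixed first-order terms cancel by symmetry, and the second derivatives of f combine to
[X,Y]f, which the bracket term removes. -/
lemma curvatureField_tensorial_right (hX : SmoothNear X x) (hY : SmoothNear Y x) :
    SmoothTensorialAt (fun Z : VField E M ↦ curvatureField X Y Z x) x where
  smul {f Z} hf hZ := by
    simp only [curvatureField_eq, covDeriv_covDeriv_smul hf hY hZ,
      covDeriv_covDeriv_smul hf hX hZ, covDeriv_smul_right hf.mdiffAt hZ.mdiffAt,
      mvfderiv_mlieBracket hX hY hf]
    module
  add {Z Z'} hZ hZ' := by
    simp only [curvatureField_eq, covDeriv_covDeriv_add hX hZ hZ',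
      covDeriv_covDeriv_add hY hZ hZ', covDeriv_add_right hZ.mdiffAt hZ'.mdiffAt]
    module

/-- Tensoriality in each slot frees the curvature from the chosen extensions, so it can be computed
with ξ itself or with a moving frame. -/
lemma riemann_eq_curvatureField (hX : SmoothNear X x) (hY : SmoothNear Y x)
    (hZ : SmoothNear Z x) : riemann x (X x) (Y x) (Z x) = curvatureField X Y Z x := by
  have s (v : TangentSpace 𝓘(ℝ, E) x) := smoothNear_extend (E := E) v
  unfold riemann
  rw [(curvatureField_tensorial_left (s _)).pointwise (s _) hX (extend_apply_self E _),
    (curvatureField_tensorial_mid (s _)).pointwise (s _) hY (extend_apply_self E _),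
    (curvatureField_tensorial_right hX hY).pointwise (s _) hZ (extend_apply_self E _)]

/-! ### Symmetries of the curvature tensor -/

section Symmetries

variable (u u' v v' w w' : TangentSpace 𝓘(ℝ, E) x)

lemma riemann_add_left : riemann x (u + u') v w = riemann x u v w + riemann x u' v w := by
  have s (v : TangentSpace 𝓘(ℝ, E) x) := smoothNear_extend (E := E) v
  have h := riemann_eq_curvatureField ((s u).add (s u')) (s v) (s w)
  rw [(curvatureField_tensorial_left (s w)).add (s u) (s u')] at h
  simpa using! h

lemma riemann_smul_left (c : ℝ) : riemann x (c • u) v w = c • riemann x u v w := by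
  have s (v : TangentSpace 𝓘(ℝ, E) x) := smoothNear_extend (E := E) v
  have h := riemann_eq_curvatureField ((s u).const_smul c) (s v) (s w)
  have hc : SmoothFunNear E (fun _ : M ↦ c) x := Eventually.of_forall fun y ↦ contMDiffAt_const
  have h2 := (curvatureField_tensorial_left (Y := extend E v) (s w)).smul hc (s u)
  simpa using! h.trans h2

lemma riemann_swap : riemann x u v w = -riemann x v u w := curvatureField_swap _ _ _ _

lemma riemann_add_right : riemann x u v (w + w') = riemann x u v w + riemann x u v w' := by
  have s (v : TangentSpace 𝓘(ℝ, E) x) := smoothNear_extend (E := E) v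
  have h := riemann_eq_curvatureField (s u) (s v) ((s w).add (s w'))
  rw [(curvatureField_tensorial_right (s u) (s v)).add (s w) (s w')] at h
  simpa using! h

lemma riemann_smul_right (c : ℝ) : riemann x u v (c • w) = c • riemann x u v w := by
  have s (v : TangentSpace 𝓘(ℝ, E) x) := smoothNear_extend (E := E) v
  have h := riemann_eq_curvatureField (s u) (s v) ((s w).const_smul c)
  have hc : SmoothFunNear E (fun _ : M ↦ c) x := Eventually.of_forall fun y ↦ contMDiffAt_const
  have h2 := (curvatureField_tensorial_right (s u) (s v)).smul hc (s w)
  simpa using! h.trans h2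

/-- The first Bianchi identity. -/
lemma riemann_bianchi : riemann x u v w + riemann x v w u + riemann x w u v = 0 := by
  have s (v : TangentSpace 𝓘(ℝ, E) x) := smoothNear_extend (E := E) v
  -- Two uses of torsion-freeness; with this the cyclic sum of curvatures reduces to the Jacobi
  -- identity.
  have key {X Y Z : VField E M} (hX : SmoothNear X x) (hY : SmoothNear Y x) (hZ : SmoothNear Z x) :
      covDeriv X (covDeriv Y Z) x = covDeriv X (covDeriv Z Y) x
        + (mlieBracket 𝓘(ℝ, E) X (mlieBracket 𝓘(ℝ, E) Y Z) x
          + covDeriv (mlieBracket 𝓘(ℝ, E) Y Z) X x) := by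
    have e : ∀ᶠ y in 𝓝 x, covDeriv Y Z y = (covDeriv Z Y + mlieBracket 𝓘(ℝ, E) Y Z) y := by
      filter_upwards [hY.eventually, hZ.eventually] with y h1 h2
      simp [← covDeriv_sub_covDeriv h1.mdiffAt h2.mdiffAt]
    rw [covDeriv_congr_right (hY.covDeriv hZ).mdiffAt
      ((hZ.covDeriv hY).add (hY.mlieBracket hZ)).mdiffAt e,
      covDeriv_add_right (hZ.covDeriv hY).mdiffAt (hY.mlieBracket hZ).mdiffAt,
      ← covDeriv_sub_covDeriv hX.mdiffAt (hY.mlieBracket hZ).mdiffAt]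
    abel
  have := isManifold_minSmoothness (E := E) (M := M) 2
  have j := mlieBracket_jacobi (s u) (s v) (s w)
  rw [mlieBracket_swap_apply (V := mlieBracket 𝓘(ℝ, E) (extend E u) (extend E v)),
    mlieBracket_swap (V := extend E u) (W := extend E w), ← neg_one_smul ℝ (mlieBracket 𝓘(ℝ, E) (extend E w) (extend E u)),
    mlieBracket_const_smul_right ((s w).mlieBracket (s u)).mdiffAt] at j
  unfold riemann
  simp only [curvatureField_eq, key (s u) (s v) (s w), key (s v) (s w) (s u), key (s w) (s u) (s v),
    j]
  module

/-- Evaluate [X,Y] g(Z,Z') both as a commutator of derivatives and by metric compatibility. The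
terms pairing ∇Z with ∇Z' are symmetric in X and Y and drop out. -/
lemma inner_riemann_skew :
    (inner ℝ (riemann x u v w) w' : ℝ) = -inner ℝ w (riemann x u v w') := by
  have s (v : TangentSpace 𝓘(ℝ, E) x) := smoothNear_extend (E := E) v
  set Z : VField E M := extend E w
  set Z' : VField E M := extend E w'
  have key {X Y : VField E M} (hX : SmoothNear X x) (hY : SmoothNear Y x) :
      mvfderiv 𝓘(ℝ, E) (fun y ↦ mvfderiv 𝓘(ℝ, E) (fun z ↦ (inner ℝ (Z z) (Z' z) : ℝ)) y (Y y)) x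
          (X x) =
        inner ℝ (covDeriv X (covDeriv Y Z) x) (Z' x) + inner ℝ (covDeriv Y Z x) (covDeriv X Z' x)
        + (inner ℝ (covDeriv X Z x) (covDeriv Y Z' x)
          + inner ℝ (Z x) (covDeriv X (covDeriv Y Z') x)) := by
    have e : (fun y ↦ mvfderiv 𝓘(ℝ, E) (fun z ↦ (inner ℝ (Z z) (Z' z) : ℝ)) y (Y y)) =ᶠ[𝓝 x]
        fun y ↦ inner ℝ (covDeriv Y Z y) (Z' y) + inner ℝ (Z y) (covDeriv Y Z' y) := by
      filter_upwards [hY.eventually, (s w).eventually, (s w').eventually] with y h1 h2 h3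
      exact mvfderiv_inner h1.mdiffAt h2.mdiffAt h3.mdiffAt
    have hYZ := hY.covDeriv (s w)
    have hYZ' := hY.covDeriv (s w')
    rw [mvfderiv, e.mfderiv_eq]
    refine Eq.trans ?_ (congr_arg₂ (· + ·) (mvfderiv_inner hX.mdiffAt hYZ.mdiffAt (s w').mdiffAt)
      (mvfderiv_inner hX.mdiffAt (s w).mdiffAt hYZ'.mdiffAt))
    have := mvfderiv_fun_add (hYZ.inner (s w')).mdiffAt ((s w).inner hYZ').mdiffAt
    exact congr($this (X x))
  have h1 := key (s u) (s v)
  have h2 := key (s v) (s u)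
  have h3 := mvfderiv_mlieBracket (s u) (s v) ((s w).inner (s w'))
  rw [h1, h2, mvfderiv_inner ((s u).mlieBracket (s v)).mdiffAt (s w).mdiffAt (s w').mdiffAt] at h3
  simp only [extend_apply_self, Z, Z'] at h3
  unfold riemann
  simp only [curvatureField_eq, inner_sub_left, inner_sub_right]
  linarith

/-- The pair symmetry of the curvature tensor. -/
lemma inner_riemann_pair :
    (inner ℝ (riemann x u v w) w' : ℝ) = inner ℝ (riemann x w w' u) v := by
  have b (a b c d : TangentSpace 𝓘(ℝ, E) x) : (inner ℝ (riemann x a b c) d : ℝ)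
      + inner ℝ (riemann x b c a) d + inner ℝ (riemann x c a b) d = 0 := by
    rw [← inner_add_left, ← inner_add_left, riemann_bianchi, inner_zero_left]
  have s1 (a b c d : TangentSpace 𝓘(ℝ, E) x) : (inner ℝ (riemann x a b c) d : ℝ) =
      -inner ℝ (riemann x b a c) d := by rw [riemann_swap, inner_neg_left]
  have s2 (a b c d : TangentSpace 𝓘(ℝ, E) x) : (inner ℝ (riemann x a b c) d : ℝ) =
      -inner ℝ (riemann x a b d) c := by rw [inner_riemann_skew, real_inner_comm]
  -- The octahedron argument: four Bianchi identities combined, with the two skew-symmetries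
  -- identifying their terms.
  linarith [b u v w w', b v w w' u, b w w' u v, b w' u v w, s1 u v w w', s2 u v w w', s1 v w u w',
    s2 v w u w', s1 w u v w', s2 w u v w', s1 v w w' u, s2 v w w' u, s1 w w' v u, s2 w w' v u,
    s1 w' v w u, s2 w' v w u, s1 w w' u v, s2 w w' u v, s1 w' u w v, s2 w' u w v, s1 u w w' v,
    s2 u w w' v, s1 w' u v w, s2 w' u v w, s1 u v w' w, s2 u v w' w, s1 v w' u w, s2 v w' u w]

end Symmetries

end ContactGeometry
end CurvatureTensor

/-! ### Ricci and scalar curvature as traces -/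

noncomputable section RicciTensor

namespace ContactGeometry

open Filter InnerProductSpace

variable {E : Type*} [NormedAddCommGroup E] [NormedSpace ℝ E] [FiniteDimensional ℝ E]
  {M : Type*} [TopologicalSpace M] [ChartedSpace E M] [IsManifold 𝓘(ℝ, E) ∞ M]
  [RiemannianBundle (fun x : M ↦ TangentSpace 𝓘(ℝ, E) x)]
  [IsContMDiffRiemannianBundle 𝓘(ℝ, E) ∞ E (fun x : M ↦ TangentSpace 𝓘(ℝ, E) x)]
  {x : M} (u u' v v' w w' : TangentSpace 𝓘(ℝ, E) x) {ι : Type*} [Fintype ι]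

lemma riemann_add_mid : riemann x u (v + v') w = riemann x u v w + riemann x u v' w := by
  rw [riemann_swap, riemann_add_left, riemann_swap u v, riemann_swap u v']; abel

lemma riemann_smul_mid (c : ℝ) : riemann x u (c • v) w = c • riemann x u v w := by
  rw [riemann_swap, riemann_smul_left, riemann_swap u v, smul_neg]

/-- Both sums are the trace of the linear map u ↦ R(u,v)w, which no orthonormal basis affects. -/
lemma ricci_eq_sum (b : OrthonormalBasis ι ℝ (TangentSpace 𝓘(ℝ, E) x)) :
    ricci x v w = ∑ i, (inner ℝ (riemann x (b i) v w) (b i) : ℝ) := by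
  let T : TangentSpace 𝓘(ℝ, E) x →ₗ[ℝ] TangentSpace 𝓘(ℝ, E) x :=
    { toFun := fun u ↦ riemann x u v w
      map_add' := fun u u' ↦ riemann_add_left u u' v w
      map_smul' := fun c u ↦ riemann_smul_left u v w c }
  have h1 := T.trace_eq_sum_inner (onb (E := E) x)
  have h2 := T.trace_eq_sum_inner b
  rw [h1] at h2
  simpa only [real_inner_comm, ricci, T, LinearMap.coe_mk, AddHom.coe_mk] using! h2

lemma ricci_comm : ricci x v w = ricci x w v := by
  unfold ricci
  refine Finset.sum_congr rfl fun i _ ↦ ?_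
  rw [inner_riemann_pair, riemann_swap, inner_neg_left, inner_riemann_skew, neg_neg,
    real_inner_comm]

lemma ricci_add_right : ricci x v (w + w') = ricci x v w + ricci x v w' := by
  simp only [ricci, riemann_add_right, inner_add_left, Finset.sum_add_distrib]

lemma ricci_smul_right (c : ℝ) : ricci x v (c • w) = c * ricci x v w := by
  simp only [ricci, riemann_smul_right, real_inner_smul_left, Finset.mul_sum]

lemma ricci_add_left : ricci x (v + v') w = ricci x v w + ricci x v' w := by
  rw [ricci_comm, ricci_add_right, ricci_comm w v, ricci_comm w v']

lemma ricci_smul_left (c : ℝ) : ricci x (c • v) w = c * ricci x v w := by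
  rw [ricci_comm, ricci_smul_right, ricci_comm w v]

lemma inner_ricciOp : (inner ℝ (ricciOp x v) w : ℝ) = ricci x v w := by
  let L : TangentSpace 𝓘(ℝ, E) x →ₗ[ℝ] ℝ :=
    { toFun := ricci x v
      map_add' := ricci_add_right v
      map_smul' := fun c w ↦ ricci_smul_right v w c }
  change _ = L w
  conv_rhs => rw [← (onb x).sum_repr' w]
  simp only [ricciOp, sum_inner, real_inner_smul_left, map_sum, map_smul, smul_eq_mul]
  exact Finset.sum_congr rfl fun i _ ↦ mul_comm _ _

lemma scalarCurv_eq_sum (b : OrthonormalBasis ι ℝ (TangentSpace 𝓘(ℝ, E) x)) :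
    scalarCurv (E := E) x = ∑ i, ricci x (b i) (b i) := by
  let T : TangentSpace 𝓘(ℝ, E) x →ₗ[ℝ] TangentSpace 𝓘(ℝ, E) x :=
    { toFun := ricciOp x
      map_add' := fun u u' ↦ ext_inner_right ℝ fun w ↦ by
        simp [inner_add_left, inner_ricciOp, ricci_add_left]
      map_smul' := fun c u ↦ ext_inner_right ℝ fun w ↦ by
        simp [real_inner_smul_left, inner_ricciOp, ricci_smul_left] }
  have h1 := T.trace_eq_sum_inner (onb (E := E) x)
  have h2 := T.trace_eq_sum_inner b
  rw [h1] at h2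
  have h (v : TangentSpace 𝓘(ℝ, E) x) : (inner ℝ v (T v) : ℝ) = ricci x v v := by
    rw [real_inner_comm]; exact inner_ricciOp v v
  simpa only [h] using! h2

lemma SmoothNear.curvatureField {X Y Z : VField E M} (hX : SmoothNear X x) (hY : SmoothNear Y x)
    (hZ : SmoothNear Z x) : SmoothNear (curvatureField X Y Z) x :=
  ((hX.covDeriv (hY.covDeriv hZ)).sub (hY.covDeriv (hX.covDeriv hZ))).sub
    ((hX.mlieBracket hY).covDeriv hZ)

variable (E M) in
-- The basis `onb` is chosen point by point, with no regularity. Basis independence allows it to be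
-- replaced by a smooth frame, in which the sum is visibly smooth.
lemma contMDiff_scalarCurv :
    ContMDiff 𝓘(ℝ, E) 𝓘(ℝ, ℝ) ∞ (fun x : M ↦ scalarCurv (E := E) x) := by
  intro x
  obtain ⟨e, he, ho⟩ := exists_orthonormal_frame (E := E) x
  have h : SmoothFunNear E (fun y ↦ ∑ j, ∑ i,
      (inner ℝ (curvatureField (e i) (e j) (e j) y) (e i y) : ℝ)) x :=
    SmoothFunNear.sum fun j _ ↦ SmoothFunNear.sum fun i _ ↦
      ((he i).curvatureField (he j) (he j)).inner (he i)
  refine Eventually.self_of_nhds (h.congr ?_)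
  filter_upwards [ho, eventually_all.2 fun i ↦ (he i).eventually] with y hy hs
  have hc : Fintype.card (Fin (finrank ℝ E)) = finrank ℝ (TangentSpace 𝓘(ℝ, E) y) := by
    rw [Fintype.card_fin]; rfl
  set b := OrthonormalBasis.mk hy (hy.linearIndependent.span_eq_top_of_card_eq_finrank' hc).ge
  rw [scalarCurv_eq_sum b]
  refine Finset.sum_congr rfl fun j _ ↦ ?_
  rw [ricci_eq_sum _ _ b]
  refine Finset.sum_congr rfl fun i _ ↦ ?_
  simp only [b, OrthonormalBasis.coe_mk]
  rw [riemann_eq_curvatureField (hs i) (hs j) (hs j)]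

end ContactGeometry
end RicciTensor

/-! ### K-contact identities: ∇ξ, ∇φ and the curvature in the direction of ξ -/

noncomputable section KContact

namespace ContactGeometry

open Filter InnerProductSpace

variable {E : Type*} [NormedAddCommGroup E] [NormedSpace ℝ E] [FiniteDimensional ℝ E]
  {M : Type*} [TopologicalSpace M] [ChartedSpace E M] [IsManifold 𝓘(ℝ, E) ∞ M]
  [RiemannianBundle (fun x : M ↦ TangentSpace 𝓘(ℝ, E) x)]
  {m : ℕ} {η : Π x : M, TangentSpace 𝓘(ℝ, E) x →L[ℝ] ℝ} {ξ : VField E M}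
  {φ : Π x : M, TangentSpace 𝓘(ℝ, E) x →L[ℝ] TangentSpace 𝓘(ℝ, E) x}
  {X Y Z : VField E M} {x : M}

lemma extDeriv1_swap (u v : TangentSpace 𝓘(ℝ, E) x) :
    extDeriv1 η x u v = -extDeriv1 η x v u := by
  unfold extDeriv1
  rw [mlieBracket_swap_apply (V := extend E u) (W := extend E v), map_neg]
  ring

namespace IsContactMetric

variable (h : IsContactMetric m η ξ φ)
include h

/-- φ inherits skewness from dη. -/
lemma inner_phi (u v : TangentSpace 𝓘(ℝ, E) x) :
    (inner ℝ (φ x u) v : ℝ) = -inner ℝ u (φ x v) := by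
  rw [← h.deta_eq, extDeriv1_swap, h.deta_eq, neg_neg, real_inner_comm]

lemma inner_xi_phi (v : TangentSpace 𝓘(ℝ, E) x) : (inner ℝ (ξ x) (φ x v) : ℝ) = 0 := by
  rw [← h.deta_eq, h.reeb]

lemma phi_xi (x : M) : φ x (ξ x) = 0 :=
  ext_inner_right ℝ fun v ↦ by rw [h.inner_phi, h.inner_xi_phi, neg_zero, inner_zero_left]

lemma inner_xi_xi (x : M) : (inner ℝ (ξ x) (ξ x) : ℝ) = 1 := by
  rw [← h.eta_eq, h.eta_xi]

lemma mdiffAt_xi : MDiffAt (T% ξ) x := (h.smooth_xi x).mdifferentiableAt (by simp)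

lemma smoothNear_xi : SmoothNear ξ x := Eventually.of_forall h.smooth_xi

lemma mdiffAt_phi (hX : MDiffAt (T% X) x) :
    MDiffAt (T% (fun y ↦ φ y (X y) : VField E M)) x :=
  ((h.smooth_phi x).mdifferentiableAt (by simp)).clm_bundle_apply
    (E₁ := fun x : M ↦ TangentSpace 𝓘(ℝ, E) x) (E₂ := fun x : M ↦ TangentSpace 𝓘(ℝ, E) x)
    (b := fun y ↦ y) hX

end IsContactMetric

variable [IsContMDiffRiemannianBundle 𝓘(ℝ, E) ∞ E (fun x : M ↦ TangentSpace 𝓘(ℝ, E) x)]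

/-- `(∇_X φ) Y = ∇_X (φ Y) - φ (∇_X Y)`. -/
def covDerivPhi (φ : Π x : M, TangentSpace 𝓘(ℝ, E) x →L[ℝ] TangentSpace 𝓘(ℝ, E) x)
    (X Y : VField E M) (x : M) : TangentSpace 𝓘(ℝ, E) x :=
  covDeriv X (fun y ↦ φ y (Y y)) x - φ x (covDeriv X Y x)

/-- Metric compatibility and zero torsion turn L_ξ g = 0 into skewness of ∇ξ. -/
lemma IsKilling.inner_covDeriv (hξ : MDiffAt (T% ξ) x) (h : IsKilling ξ)
    (hX : MDiffAt (T% X) x) (hY : MDiffAt (T% Y) x) :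
    (inner ℝ (covDeriv X ξ x) (Y x) : ℝ) = -inner ℝ (X x) (covDeriv Y ξ x) := by
  have h1 := h x X Y hX hY
  rw [mvfderiv_inner hξ hX hY, ← covDeriv_sub_covDeriv hξ hX, ← covDeriv_sub_covDeriv hξ hY,
    inner_sub_left, inner_sub_right] at h1
  linarith

namespace IsKContact

variable (h : IsKContact m η ξ φ)
include h

/-- On a K-contact manifold `∇_X ξ = -φ X`. -/
lemma covDeriv_xi (X : VField E M) : covDeriv X ξ = -(fun y ↦ φ y (X y)) := by
  funext x
  refine ext_inner_right ℝ fun w ↦ ?_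
  have hX := mdiffAt_ext (E := E) (X x)
  have hw := mdiffAt_ext (E := E) w
  have hξ := h.mdiffAt_xi (x := x)
  -- ∇_X ξ at x depends only on X(x), so X may be arbitrary and is replaced by a smooth extension of
  -- its value.
  have e1 : covDeriv X ξ x = covDeriv (extend E (X x)) ξ x := by simp [covDeriv]
  have h1 := h.killing.inner_covDeriv hξ hX hw
  have h2 := h.deta_eq x (X x) w
  simp only [extDeriv1, h.eta_eq] at h2
  have h3 := mvfderiv_inner hX hξ hw
  have h4 := mvfderiv_inner hw hξ hX
  simp only [extend_apply_self] at h1 h3 h4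
  rw [h3, h4, ← covDeriv_sub_covDeriv hX hw, inner_sub_right] at h2
  rw [e1, Pi.neg_apply, inner_neg_left, h.inner_phi, neg_neg, ← h2]
  rw [real_inner_comm] at h1
  linarith [real_inner_comm (X x) (covDeriv (extend E w) ξ x),
    real_inner_comm w (covDeriv (extend E (X x)) ξ x)]

lemma covDerivPhi_tensorial (X : VField E M) :
    TensorialAt 𝓘(ℝ, E) E (fun Y : VField E M ↦ covDerivPhi φ X Y x) x where
  smul {f Y} hf hY := by
    have e : (fun y ↦ φ y ((f • Y) y)) = f • (fun y ↦ φ y (Y y) : VField E M) := by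
      funext y; simp
    simp only [covDerivPhi, e, covDeriv_smul_right hf hY,
      covDeriv_smul_right hf (h.mdiffAt_phi hY), map_add, map_smul]
    module
  add {Y Z} hY hZ := by
    have e : (fun y ↦ φ y ((Y + Z) y)) =
        (fun y ↦ φ y (Y y) : VField E M) + (fun y ↦ φ y (Z y) : VField E M) := by
      funext y; simp
    simp only [covDerivPhi, e, covDeriv_add_right hY hZ,
      covDeriv_add_right (h.mdiffAt_phi hY) (h.mdiffAt_phi hZ), map_add]
    module

lemma covDerivPhi_extend (hY : MDiffAt (T% Y) x) :
    covDerivPhi φ (extend E (X x)) (extend E (Y x)) x = covDerivPhi φ X Y x := by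
  rw [(h.covDerivPhi_tensorial _).pointwise (mdiffAt_ext _) hY (extend_apply_self E _)]
  simp [covDerivPhi, covDeriv]

/-- Differentiate g(φY,Z) = -g(Y,φZ), the metric being parallel. -/
lemma inner_covDerivPhi (hX : MDiffAt (T% X) x) (hY : MDiffAt (T% Y) x) (hZ : MDiffAt (T% Z) x) :
    (inner ℝ (covDerivPhi φ X Y x) (Z x) : ℝ) = -inner ℝ (Y x) (covDerivPhi φ X Z x) := by
  have h1 := mvfderiv_inner hX (h.mdiffAt_phi hY) hZ
  have h2 := mvfderiv_inner hX hY (h.mdiffAt_phi hZ)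
  simp only [h.inner_phi] at h1
  have e : (fun y ↦ -(inner ℝ (Y y) (φ y (Z y)) : ℝ)) =
    -(fun y ↦ (inner ℝ (Y y) (φ y (Z y)) : ℝ)) := rfl
  rw [e, mvfderiv_neg, neg_apply, h2] at h1
  simp only [covDerivPhi, inner_sub_left, inner_sub_right, h.inner_phi]
  linarith

/-- This is the covariant derivative of φ² = -I + η⊗ξ, with ∇_X ξ = -φX inserted. -/
lemma covDerivPhi_phi (hX : MDiffAt (T% X) x) (hY : MDiffAt (T% Y) x) :
    covDerivPhi φ X (fun y ↦ φ y (Y y)) x + φ x (covDerivPhi φ X Y x) =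
      -(inner ℝ (φ x (X x)) (Y x) : ℝ) • ξ x - (inner ℝ (ξ x) (Y x) : ℝ) • φ x (X x) := by
  have hξ := h.mdiffAt_xi (x := x)
  have e : (fun y ↦ φ y (φ y (Y y))) =
      (-Y + (fun y ↦ (inner ℝ (ξ y) (Y y) : ℝ)) • ξ : VField E M) := by
    funext y; simp [h.phi_sq, h.eta_eq]
  have hf := mdifferentiableAt_inner hξ hY
  have hn : MDiffAt (T% (-Y)) x := mdifferentiableAt_neg_section hY
  simp only [covDerivPhi]
  rw [e, map_sub, h.phi_sq, h.eta_eq, covDeriv_add_right hn (hf.smul_section hξ), covDeriv_neg_right hY,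
    covDeriv_smul_right hf hξ, mvfderiv_inner hX hξ hY, h.covDeriv_xi]
  simp only [Pi.neg_apply, inner_neg_left]
  module

lemma curvatureField_xi (hX : MDiffAt (T% X) x) (hY : MDiffAt (T% Y) x) :
    curvatureField X Y ξ x = covDerivPhi φ Y X x - covDerivPhi φ X Y x := by
  rw [curvatureField_eq, h.covDeriv_xi, h.covDeriv_xi, h.covDeriv_xi,
    covDeriv_neg_right (h.mdiffAt_phi hX), covDeriv_neg_right (h.mdiffAt_phi hY)]
  simp only [covDerivPhi, Pi.neg_apply, ← covDeriv_sub_covDeriv hX hY, map_sub]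
  abel

/-- The Bianchi identity paired with ξ makes the cyclic sum of g((∇_u φ)v, w) vanish. Together with
skewness this collapses the two terms of `curvatureField_xi` into one. -/
lemma inner_riemann_xi (u v w : TangentSpace 𝓘(ℝ, E) x) :
    (inner ℝ (riemann x u v (ξ x)) w : ℝ) =
      inner ℝ (covDerivPhi φ (extend E w) (extend E u) x) v := by
  have hd (v : TangentSpace 𝓘(ℝ, E) x) := mdiffAt_ext (E := E) v
  have r (u v : TangentSpace 𝓘(ℝ, E) x) : riemann x u v (ξ x) =
      covDerivPhi φ (extend E v) (extend E u) x - covDerivPhi φ (extend E u) (extend E v) x := by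
    have := riemann_eq_curvatureField (smoothNear_extend u) (smoothNear_extend v)
      (h.smoothNear_xi (x := x))
    rw [h.curvatureField_xi (hd u) (hd v)] at this
    simpa using this
  have sk (a b c : TangentSpace 𝓘(ℝ, E) x) :
      (inner ℝ (covDerivPhi φ (extend E a) (extend E b) x) c : ℝ) =
        -inner ℝ (covDerivPhi φ (extend E a) (extend E c) x) b := by
    have := h.inner_covDerivPhi (hd a) (hd b) (hd c)
    rw [extend_apply_self, extend_apply_self] at this
    rw [this, real_inner_comm]
  have c : (inner ℝ (riemann x u v (ξ x)) w : ℝ) + inner ℝ (riemann x v w (ξ x)) u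
      + inner ℝ (riemann x w u (ξ x)) v = 0 := by
    rw [inner_riemann_skew, inner_riemann_skew, inner_riemann_skew, ← neg_add, ← neg_add,
      ← inner_add_right, ← inner_add_right, riemann_bianchi, inner_zero_right, neg_zero]
  rw [r, r, r] at c
  rw [r]
  simp only [inner_sub_left] at c ⊢
  linarith [sk u v w, sk v w u, sk w u v, sk u w v, sk v u w, sk w v u]

/-- On a K-contact manifold `(∇_X φ) Y = R(ξ, X) Y`. -/
lemma covDerivPhi_eq_riemann (hY : MDiffAt (T% Y) x) :
    covDerivPhi φ X Y x = riemann x (ξ x) (X x) (Y x) := by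
  refine ext_inner_right ℝ fun v ↦ ?_
  rw [← h.covDerivPhi_extend hY, ← h.inner_riemann_xi, inner_riemann_pair]

/-! ### Curvature identities at a point -/

lemma riemann_xi_phi (u v : TangentSpace 𝓘(ℝ, E) x) :
    riemann x (ξ x) u (φ x v) + φ x (riemann x (ξ x) u v) =
      -(inner ℝ (φ x u) v : ℝ) • ξ x - (inner ℝ (ξ x) v : ℝ) • φ x u := by
  have hv := mdiffAt_ext (E := E) v
  have := h.covDerivPhi_phi (mdiffAt_ext (E := E) u) hv
  rw [h.covDerivPhi_eq_riemann hv, h.covDerivPhi_eq_riemann (h.mdiffAt_phi hv)] at this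
  simpa only [extend_apply_self] using this

lemma riemann_xi_xi_right (u : TangentSpace 𝓘(ℝ, E) x) :
    riemann x (ξ x) u (ξ x) = (inner ℝ (ξ x) u : ℝ) • ξ x - u := by
  have h1 := h.covDerivPhi_eq_riemann (X := extend E u) (h.mdiffAt_xi (x := x))
  -- Since φξ = 0, only -φ(∇_u ξ) = φ²u is left of (∇_u φ)ξ.
  have h0 : covDeriv (extend E u) (fun y ↦ φ y (ξ y)) x = 0 := by
    have : (fun y ↦ φ y (ξ y)) = (0 : VField E M) := funext fun y ↦ h.phi_xi y
    rw [this]; simp [covDeriv]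
  rw [extend_apply_self, covDerivPhi, h0, h.covDeriv_xi] at h1
  simp only [Pi.neg_apply, extend_apply_self, map_neg, h.phi_sq, h.eta_eq] at h1
  rw [← h1]; module

lemma riemann_xi_xi (u : TangentSpace 𝓘(ℝ, E) x) :
    riemann x u (ξ x) (ξ x) = u - (inner ℝ (ξ x) u : ℝ) • ξ x := by
  rw [riemann_swap, h.riemann_xi_xi_right]; module

lemma ricci_xi_xi (x : M) : ricci x (ξ x) (ξ x) = (finrank ℝ E : ℝ) - 1 := by
  simp only [ricci, h.riemann_xi_xi, inner_sub_left, real_inner_smul_left, Finset.sum_sub_distrib,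
    real_inner_self_eq_norm_sq, OrthonormalBasis.norm_eq_one]
  have := (onb (E := E) x).sum_inner_mul_inner (ξ x) (ξ x)
  rw [h.inner_xi_xi] at this
  simp only [real_inner_comm] at this ⊢
  rw [this]
  simp
  rfl

end IsKContact

end ContactGeometry
end KContact

/-! ### The Ricci tensor along ξ, the Weyl conditions and normality -/

noncomputable section WeylTensor

namespace ContactGeometry

open Filter InnerProductSpace

/-- The matrix of φ in an orthonormal basis is skew, so exchanging the summation indices changes the
sign. B need not be symmetric. -/
lemma sum_bilin_skew {V ι : Type*} [NormedAddCommGroup V] [InnerProductSpace ℝ V] [Fintype ι]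
    (b : OrthonormalBasis ι ℝ V) (B : V →ₗ[ℝ] V →ₗ[ℝ] ℝ) (φ : V → V)
    (hφ : ∀ u v, (inner ℝ (φ u) v : ℝ) = -inner ℝ u (φ v)) :
    ∑ i, B (φ (b i)) (b i) = -∑ i, B (b i) (φ (b i)) := by
  have h1 (i) : B (φ (b i)) (b i) = ∑ j, (inner ℝ (b j) (φ (b i)) : ℝ) * B (b j) (b i) := by
    conv_lhs => rw [← b.sum_repr' (φ (b i))]
    simp
  have h2 (i) : B (b i) (φ (b i)) = ∑ j, (inner ℝ (b j) (φ (b i)) : ℝ) * B (b i) (b j) := by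
    conv_lhs => rw [← b.sum_repr' (φ (b i))]
    simp
  simp only [h1, h2]
  rw [Finset.sum_comm (f := fun i j ↦ (inner ℝ (b j) (φ (b i)) : ℝ) * B (b i) (b j)),
    ← Finset.sum_neg_distrib]
  refine Finset.sum_congr rfl fun i _ ↦ ?_
  rw [← Finset.sum_neg_distrib]
  refine Finset.sum_congr rfl fun j _ ↦ ?_
  rw [real_inner_comm, hφ]
  ring

variable {E : Type*} [NormedAddCommGroup E] [NormedSpace ℝ E] [FiniteDimensional ℝ E]
  {M : Type*} [TopologicalSpace M] [ChartedSpace E M] [IsManifold 𝓘(ℝ, E) ∞ M]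
  [RiemannianBundle (fun x : M ↦ TangentSpace 𝓘(ℝ, E) x)]
  [IsContMDiffRiemannianBundle 𝓘(ℝ, E) ∞ E (fun x : M ↦ TangentSpace 𝓘(ℝ, E) x)]
  {m : ℕ} {η : Π x : M, TangentSpace 𝓘(ℝ, E) x →L[ℝ] ℝ} {ξ : VField E M}
  {φ : Π x : M, TangentSpace 𝓘(ℝ, E) x →L[ℝ] TangentSpace 𝓘(ℝ, E) x}
  {X Y Z : VField E M} {x : M}

namespace IsKContact

variable (h : IsKContact m η ξ φ)
include h

/-- With A(a,b,c) = g(R(ξ,a)b, c), the value Ric(ξ,φv) is the trace of A(e,e,φv). Moving φ across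
turns this into the trace of A(e,φe,v), up to terms that sum to zero because φ is skew and its range
is orthogonal to ξ. -/
lemma ricci_xi_phi (v : TangentSpace 𝓘(ℝ, E) x) : ricci x (ξ x) (φ x v) = 0 := by
  set A : TangentSpace 𝓘(ℝ, E) x → TangentSpace 𝓘(ℝ, E) x → TangentSpace 𝓘(ℝ, E) x → ℝ :=
    fun a b c ↦ inner ℝ (riemann x (ξ x) a b) c
  have skew (a b c) : A a b c = -A a c b := by
    simp only [A]; rw [inner_riemann_skew, real_inner_comm]
  have cyc (a b c) : A a b c + A b c a + A c a b = 0 := by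
    simp only [A]
    rw [inner_riemann_pair, inner_riemann_pair (ξ x) b, inner_riemann_pair (ξ x) c,
      inner_riemann_skew, inner_riemann_skew, inner_riemann_skew, ← neg_add, ← neg_add,
      ← inner_add_right, ← inner_add_right, riemann_bianchi, inner_zero_right, neg_zero]
  have hφ (a b c) : A a (φ x b) c = A a b (φ x c) - inner ℝ (φ x a) b * inner ℝ (ξ x) c
      - inner ℝ (ξ x) b * inner ℝ (φ x a) c := by
    have := congr_arg (fun z ↦ (inner ℝ z c : ℝ)) (h.riemann_xi_phi a b)
    simp only [inner_add_left, inner_sub_left, real_inner_smul_left,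
      h.inner_phi (riemann x (ξ x) a b)] at this
    simp only [A]
    linarith
  set e := onb (E := E) x
  let B : TangentSpace 𝓘(ℝ, E) x →ₗ[ℝ] TangentSpace 𝓘(ℝ, E) x →ₗ[ℝ] ℝ :=
    LinearMap.mk₂ ℝ (fun a b ↦ A a b v)
      (fun a a' b ↦ by simp only [A, riemann_add_mid, inner_add_left])
      (fun c a b ↦ by simp only [A, riemann_smul_mid, real_inner_smul_left, smul_eq_mul])
      (fun a b b' ↦ by simp only [A, riemann_add_right, inner_add_left])
      (fun c a b ↦ by simp only [A, riemann_smul_right, real_inner_smul_left, smul_eq_mul])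
  have hB := sum_bilin_skew e B (φ x) h.inner_phi
  simp only [B, LinearMap.mk₂_apply] at hB
  have s1 (w) : ∑ i, (inner ℝ (ξ x) (e i) : ℝ) * inner ℝ (φ x w) (e i) = 0 := by
    have := e.sum_inner_mul_inner (ξ x) (φ x w)
    simpa only [real_inner_comm, h.inner_xi_phi] using this
  have s2 : ∑ i, (inner ℝ (ξ x) (e i) : ℝ) * inner ℝ (φ x (e i)) v = 0 := by
    rw [← neg_eq_zero, ← s1 v, ← Finset.sum_neg_distrib]
    refine Finset.sum_congr rfl fun i _ ↦ ?_
    have : (inner ℝ (φ x (e i)) v : ℝ) = -inner ℝ (φ x v) (e i) := by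
      rw [h.inner_phi, real_inner_comm]
    rw [this]; ring
  have t0 : ∑ i, A (e i) (φ x (e i)) v = 0 := by
    -- Skewness and `hφ` give A(v,e,φe) = η(e) g(φv,e), which evaluates the third term of the cyclic
    -- identity. After summation, `hB` makes the first two terms equal, so twice the trace is zero.
    have hi (i) : A (e i) (φ x (e i)) v - A (φ x (e i)) (e i) v
        + inner ℝ (ξ x) (e i) * inner ℝ (φ x v) (e i) = 0 := by
      linarith [cyc (e i) (φ x (e i)) v, skew (φ x (e i)) v (e i), hφ v (e i) (e i),
        skew v (φ x (e i)) (e i)]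
    have := Finset.sum_congr (s₁ := Finset.univ) rfl fun i _ ↦ hi i
    simp only [Finset.sum_add_distrib, Finset.sum_sub_distrib, hB, s1, Finset.sum_const_zero] at this
    linarith
  have hr (i) : (inner ℝ (riemann x (e i) (ξ x) (φ x v)) (e i) : ℝ) =
      A (e i) (φ x (e i)) v + inner ℝ (ξ x) (e i) * inner ℝ (φ x (e i)) v := by
    rw [riemann_swap, inner_neg_left]
    have z := h.inner_phi (e i) (e i)
    rw [real_inner_comm] at z
    have z' : (inner ℝ (φ x (e i)) (e i) : ℝ) = 0 := by
      rw [real_inner_comm]; linarith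
    have := hφ (e i) (e i) v
    rw [z'] at this
    linarith [skew (e i) (φ x v) (e i)]
  simp only [ricci]
  rw [Finset.sum_congr rfl fun i _ ↦ hr i, Finset.sum_add_distrib, t0, s2, add_zero]

/-- On a K-contact manifold `Ric(ξ, ·) = (n - 1) η`. -/
lemma ricci_xi (v : TangentSpace 𝓘(ℝ, E) x) :
    ricci x (ξ x) v = ((finrank ℝ E : ℝ) - 1) * inner ℝ (ξ x) v := by
  -- The splitting of v along the range of φ and along ξ.
  have hv : v = (-1 : ℝ) • φ x (φ x v) + (inner ℝ (ξ x) v : ℝ) • ξ x := by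
    rw [h.phi_sq, h.eta_eq]; module
  conv_lhs => rw [hv]
  rw [ricci_add_right, ricci_smul_right, ricci_smul_right, h.ricci_xi_phi, h.ricci_xi_xi]
  ring

/-- With Ric(ξ,·) known, the only curvature unknowns left are R(u,v)ξ, the scalar curvature and the
values Ric(u,w), Ric(v,w). -/
lemma inner_weyl_xi (u v w : TangentSpace 𝓘(ℝ, E) x) :
    (inner ℝ (weyl x u v (ξ x)) w : ℝ) = inner ℝ (riemann x u v (ξ x)) w
      + (1 / ((finrank ℝ E : ℝ) - 2)) * (((finrank ℝ E : ℝ) - 1) * inner ℝ (ξ x) u * inner ℝ v w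
        - ((finrank ℝ E : ℝ) - 1) * inner ℝ (ξ x) v * inner ℝ u w
        + inner ℝ (ξ x) u * ricci x v w - inner ℝ (ξ x) v * ricci x u w)
      - scalarCurv (E := E) x / (((finrank ℝ E : ℝ) - 1) * ((finrank ℝ E : ℝ) - 2)) *
        (inner ℝ (ξ x) u * inner ℝ v w - inner ℝ (ξ x) v * inner ℝ u w) := by
  simp only [weyl, inner_add_left, inner_sub_left, real_inner_smul_left, inner_ricciOp,
    ricci_comm _ (ξ x), h.ricci_xi, real_inner_comm (ξ x)]

lemma two_lt_finrank (hm : 1 ≤ m) : (2 : ℝ) < finrank ℝ E := by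
  rw [h.dim]; exact_mod_cast (by omega : 2 < 2 * m + 1)

/-- `W(X, ξ) ξ = 0` determines the Ricci tensor. -/
lemma weyl_xi_xi_eq_zero_iff (hm : 1 ≤ m) (u : TangentSpace 𝓘(ℝ, E) x) :
    weyl x u (ξ x) (ξ x) = 0 ↔ ∀ w, ricci x u w =
      (scalarCurv (E := E) x / ((finrank ℝ E : ℝ) - 1) - 1) * inner ℝ u w
      + ((finrank ℝ E : ℝ) - scalarCurv (E := E) x / ((finrank ℝ E : ℝ) - 1))
        * (inner ℝ (ξ x) u * inner ℝ (ξ x) w) := by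
  have hn := h.two_lt_finrank hm
  have h2 : (finrank ℝ E : ℝ) - 2 ≠ 0 := by linarith
  have h1 : (finrank ℝ E : ℝ) - 1 ≠ 0 := by linarith
  -- The Weyl component is 1/(n-2) times the defect in the claimed Ricci formula; n > 2 makes the
  -- factor nonzero.
  have key (w) : (inner ℝ (weyl x u (ξ x) (ξ x)) w : ℝ) = (1 / ((finrank ℝ E : ℝ) - 2)) *
      ((scalarCurv (E := E) x / ((finrank ℝ E : ℝ) - 1) - 1) * inner ℝ u w
      + ((finrank ℝ E : ℝ) - scalarCurv (E := E) x / ((finrank ℝ E : ℝ) - 1))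
        * (inner ℝ (ξ x) u * inner ℝ (ξ x) w) - ricci x u w) := by
    rw [h.inner_weyl_xi, h.riemann_xi_xi, inner_sub_left, real_inner_smul_left, h.ricci_xi,
      h.inner_xi_xi]
    field_simp
    ring
  constructor
  · intro h0 w
    have := key w
    rw [h0, inner_zero_left] at this
    have := (mul_eq_zero.1 this.symm).resolve_left (one_div_ne_zero h2)
    linarith
  · intro h0
    refine ext_inner_right ℝ fun w ↦ ?_
    rw [key, h0, sub_self, mul_zero, inner_zero_left]

lemma isEtaEinstein_of_ricci {a b : M → ℝ} (ha : ContMDiff 𝓘(ℝ, E) 𝓘(ℝ, ℝ) ∞ a)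
    (hb : ContMDiff 𝓘(ℝ, E) 𝓘(ℝ, ℝ) ∞ b)
    (hab : ∀ (x : M) (u w : TangentSpace 𝓘(ℝ, E) x),
      ricci x u w = a x * inner ℝ u w + b x * (inner ℝ (ξ x) u * inner ℝ (ξ x) w)) :
    IsEtaEinstein η :=
  ⟨a, b, ha, hb, fun x u w ↦ by rw [hab, h.eta_eq, h.eta_eq]⟩

theorem weyl_xi_xi_iff_isEtaEinstein (hm : 1 ≤ m) :
    (∀ (x : M) (u : TangentSpace 𝓘(ℝ, E) x), weyl x u (ξ x) (ξ x) = 0) ↔ IsEtaEinstein η := by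
  have hn := h.two_lt_finrank hm
  have h1 : (finrank ℝ E : ℝ) - 1 ≠ 0 := by linarith
  simp only [h.weyl_xi_xi_eq_zero_iff hm]
  constructor
  · intro hr
    have hs := (contMDiff_scalarCurv E M).div_const ((finrank ℝ E : ℝ) - 1)
    exact h.isEtaEinstein_of_ricci (hs.sub contMDiff_const) (contMDiff_const.sub hs) hr
  · rintro ⟨a, b, -, -, hab⟩ x u w
    simp only [h.eta_eq] at hab
    -- Evaluation at ξ gives a + b = n - 1, and the trace below gives r = na + b; these two
    -- equations determine a and b.
    have hx := hab x (ξ x) (ξ x)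
    rw [h.ricci_xi_xi, h.inner_xi_xi] at hx
    have hs : scalarCurv (E := E) x = finrank ℝ E * a x + b x := by
      have hξ := (onb (E := E) x).sum_inner_mul_inner (ξ x) (ξ x)
      simp only [h.inner_xi_xi, real_inner_comm (ξ x)] at hξ
      simp only [scalarCurv, hab, real_inner_self_eq_norm_sq, OrthonormalBasis.norm_eq_one,
        Finset.sum_add_distrib, ← Finset.mul_sum, hξ]
      simp only [one_pow, mul_one, Finset.sum_const, Finset.card_univ, Fintype.card_fin,
        nsmul_eq_mul, add_left_inj]
      exact mul_comm _ _
    have hb : b x = (finrank ℝ E : ℝ) - 1 - a x := by linarith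
    rw [hab, hs, hb]
    field_simp
    ring

theorem isQuasiEinstein (hE : IsEtaEinstein η) : IsQuasiEinstein ξ := by
  obtain ⟨a, b, ha, hb, hab⟩ := hE
  exact ⟨h.inner_xi_xi, a, b, ha, hb, fun x v w ↦ by rw [hab, h.eta_eq, h.eta_eq]⟩

/-- The case v = ξ already fixes the Ricci tensor; substituting it into the general case cancels the
scalar curvature. -/
lemma riemann_xi_of_weyl (hm : 1 ≤ m)
    (hW : ∀ u v : TangentSpace 𝓘(ℝ, E) x, weyl x u v (ξ x) = 0) (u v : TangentSpace 𝓘(ℝ, E) x) :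
    riemann x u v (ξ x) = (inner ℝ (ξ x) v : ℝ) • u - (inner ℝ (ξ x) u : ℝ) • v := by
  have hn := h.two_lt_finrank hm
  have h2 : (finrank ℝ E : ℝ) - 2 ≠ 0 := by linarith
  have h1 : (finrank ℝ E : ℝ) - 1 ≠ 0 := by linarith
  refine ext_inner_right ℝ fun w ↦ ?_
  have hw := h.inner_weyl_xi u v w
  rw [hW, inner_zero_left, (h.weyl_xi_xi_eq_zero_iff hm u).1 (hW u _),
    (h.weyl_xi_xi_eq_zero_iff hm v).1 (hW v _)] at hw
  rw [inner_sub_left, real_inner_smul_left, real_inner_smul_left]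
  field_simp at hw
  have h3 : ((finrank ℝ E : ℝ) - 1) * ((finrank ℝ E : ℝ) - 2) ≠ 0 := mul_ne_zero h1 h2
  refine mul_left_cancel₀ h3 ?_
  linear_combination -hw

/-- A K-contact manifold with `R(X, Y) ξ = η(Y) X - η(X) Y` is Sasakian. -/
theorem isSasakian_of_riemann_xi (hR : ∀ (x : M) (u v : TangentSpace 𝓘(ℝ, E) x),
      riemann x u v (ξ x) = (inner ℝ (ξ x) v : ℝ) • u - (inner ℝ (ξ x) u : ℝ) • v) :
    IsSasakian m η ξ φ := by
  refine ⟨h.toIsContactMetric, fun x X Y hX hY ↦ ?_⟩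
  -- Pair symmetry carries the hypothesis on R(·,·)ξ over to R(ξ,X)Y = (∇_X φ)Y.
  have hD {X Y : VField E M} (hY : MDiffAt (T% Y) x) : covDerivPhi φ X Y x =
      (inner ℝ (X x) (Y x) : ℝ) • ξ x - (inner ℝ (ξ x) (Y x) : ℝ) • X x := by
    rw [h.covDerivPhi_eq_riemann hY]
    refine ext_inner_right ℝ fun w ↦ ?_
    rw [inner_riemann_pair, hR]
    simp only [inner_sub_left, real_inner_smul_left]
    rw [real_inner_comm (X x) (Y x), real_inner_comm (X x) w]
    ring
  have hφX := h.mdiffAt_phi hX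
  have hφY := h.mdiffAt_phi hY
  -- Zero torsion writes each bracket as a difference of covariant derivatives; the terms not
  -- involving ∇φ cancel.
  have hN : nijenhuis φ X Y x = covDerivPhi φ (fun y ↦ φ y (X y)) Y x
      - covDerivPhi φ (fun y ↦ φ y (Y y)) X x
      - φ x (covDerivPhi φ X Y x) + φ x (covDerivPhi φ Y X x) := by
    simp only [nijenhuis, covDerivPhi, ← covDeriv_sub_covDeriv hX hY,
      ← covDeriv_sub_covDeriv hφX hφY, ← covDeriv_sub_covDeriv hφX hY,
      ← covDeriv_sub_covDeriv hX hφY, map_sub]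
    abel
  rw [hN, hD hX, hD hX, hD hY, hD hY, h.deta_eq]
  simp only [map_sub, map_smul, h.phi_xi, h.inner_phi]
  have hs : (inner ℝ (Y x) (φ x (X x)) : ℝ) = -inner ℝ (X x) (φ x (Y x)) := by
    rw [real_inner_comm, h.inner_phi]
  rw [hs]
  module

end IsKContact

end ContactGeometry
end WeylTensor

theorem proposition1p1
    {E : Type*} [NormedAddCommGroup E] [NormedSpace ℝ E] [FiniteDimensional ℝ E]
    {M : Type*} [TopologicalSpace M] [ChartedSpace E M] [IsManifold 𝓘(ℝ, E) ∞ M]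
    [RiemannianBundle (fun x : M ↦ TangentSpace 𝓘(ℝ, E) x)]
    [IsContMDiffRiemannianBundle 𝓘(ℝ, E) ∞ E (fun x : M ↦ TangentSpace 𝓘(ℝ, E) x)]
    (m : ℕ) (hm : 1 ≤ m)
    (η : Π x : M, TangentSpace 𝓘(ℝ, E) x →L[ℝ] ℝ)
    (ξ : Π x : M, TangentSpace 𝓘(ℝ, E) x)
    (φ : Π x : M, TangentSpace 𝓘(ℝ, E) x →L[ℝ] TangentSpace 𝓘(ℝ, E) x)
    (hK : ContactGeometry.IsKContact m η ξ φ) :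
    ((∀ (x : M) (u : TangentSpace 𝓘(ℝ, E) x), ContactGeometry.weyl x u (ξ x) (ξ x) = 0) ↔
        ContactGeometry.IsEtaEinstein η) ∧
      ((∀ (x : M) (u v : TangentSpace 𝓘(ℝ, E) x), ContactGeometry.weyl x u v (ξ x) = 0) →
        ContactGeometry.IsSasakian m η ξ φ ∧ ContactGeometry.IsEtaEinstein η ∧
          ContactGeometry.IsQuasiEinstein ξ) := by
  have hi := hK.weyl_xi_xi_iff_isEtaEinstein hm
  refine ⟨hi, fun hW ↦ ?_⟩
  have hE := hi.1 fun x u ↦ hW x u (ξ x)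
  exact ⟨hK.isSasakian_of_riemann_xi fun x ↦ hK.riemann_xi_of_weyl hm (hW x), hE,
    hK.isQuasiEinstein hE⟩
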